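/- **Conventions.** A *vocabulary* $L$ consists of $n$-ary function symbols and $n$-ary predicate symbols, $n\ge 0$. A *metric $L$-structure* $M$ is a nonempty metric space $(M,d)$ with $d\le 1$, together with a uniformly continuous map $M^n\to M$ for every $n$-ary function symbol and a uniformly continuous map $M^n\to[0,1]$ for every $n$-ary predicate symbol of $L$ (maximum metric on $M^n$; the metric is kept in all reducts). $M$ is *complete* if $(M,d)$ is. A predicate is *discrete* if its values lie in $\{0,1\}$; its *truth set* is then the set where it equals $1$. If $A\subseteq M$ is nonempty and $L$-closed (closed under the functions of $L$), $M\restriction A$ is the $L$-structure induced on $A$. A *logic for metric structures* $\mathscr L$ consists of a class of metric structures (the *structures of $\mathscr L$*), closed under isomorphism, renaming of symbols, reducts and expansions by constants; for each $L$ a collection $\mathrm{Sent}(L)$ of $L$-sentences; and a truth value $\varphi^M\in[0,1]$ for each $L$-structure $M$ of $\mathscr L$ and each $\varphi\in\mathrm{Sent}(L)$, such that: * truth values are isomorphism invariant; if $\iota\colon L\to L'$ is an injective map of symbols preserving kind and arity and $\varphi\in\mathrm{Sent}(L)$, there is $\varphi'\in\mathrm{Sent}(L')$ whose value in every $L'$-structure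 $M$ of $\mathscr L$ is the value of $\varphi$ in the reduct of $M$ along $\iota$; * for closed terms $t_1,\dots,t_n,s,t$ and a predicate symbol $P$ there are $L$-sentences with values $P^M(t_1^M,\dots,t_n^M)$ and $d(s^M,t^M)$; for each rational $r\in[0,1]$ there is an $L$-sentence with constant value $r$; for $\varphi,\psi\in\mathrm{Sent}(L)$ there is an $L$-sentence with value $\min\{1-\varphi^M+\psi^M,1\}$; * calling a sentence $\varphi(x)$ of $L\cup\{x\}$, $x$ a new constant symbol, an *$L$-formula* and writing $\varphi[a]^M$ for its value in the expansion $(M,a)$, there are $L$-sentences with values $\sup_{a\in M}\varphi[a]^M$ and $\inf_{a\in M}\varphi[a]^M$. A *theory* is a set $T$ of $L$-sentences; a *model* of $T$ is an $L$-structure of $\mathscr L$ in which every member of $T$ has value $1$. $\mathscr L$ is *$[\omega,\omega]$-compact* if, for every $L$ and every countable family $\mathcal T$ of $L$-theories which is *uniform* (to every function symbol and every predicate symbol $s$ there is $\Delta_s\colon(0,\infty)\to(0,\infty)$ that is a modulus of uniform continuity of $s^M$, i.e. $d(x,y)<\Delta_s(\epsilon)$ implies that $s^M(x),s^M(y)$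 are at distance at most $\epsilon$, for all models $M$ of all $T\in\mathcal T$), $\bigcup\mathcal T$ has a model whenever $\bigcup\mathcal T_0$ has a model for every finite $\mathcal T_0\subseteq\mathcal T$. $\mathscr L$ is *regular* if it permits relativization to definable families of predicates: for every $L$, every $\varphi\in\mathrm{Sent}(L)$, every $L'\supseteq L$ and every binary predicate symbol $R\in L'\setminus L$ there is an $L'$-formula $\psi(y)$ such that, for every $L'$-structure $M$ of $\mathscr L$ in which $R$ is discrete and all sets $R_b=\{x: R^M(x,b)=1\}$, $b\in M$, are nonempty and $L$-closed, and for every $b\in M$, the $L$-structure $(M\restriction L)\restriction R_b$ is a structure of $\mathscr L$ and $\psi[b]^M=\varphi^{(M\restriction L)\restriction R_b}$. $\mathscr L$ is *closed under discrete sums* if it has the following property. Let $K$ be a metric $L$-structure whose universe is partitioned into nonempty parts, points of different parts having distance $1$. For each part $A$ let $L_A\subseteq L$ be such that $A$ is closed under the functions of $L_A$, and suppose that $A$ is a single point or that the $L_A$-structure $(K\restriction L_A)\restriction A$ is a structure of $\mathscr L$. Suppose that $s^K(\bar x)=s^K(\bar y)$ for every symbol $s$ of $L$ and all tuples $\bar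 x,\bar y$ with $x_k,y_k$ in the same part for each $k$, except possibly when all entries lie in one part $A$ and $s\in L_A$. Suppose finally that every truth value of a predicate symbol in $K$ is $0$, $1$, or a truth value of some predicate symbol in some structure of $\mathscr L$. Then $K$ is a structure of $\mathscr L$. For a vocabulary $L$ let $L^{\mathrm u}$ arise by making every $0$-ary function or predicate symbol unary, and for an $L$-structure $M$ let $M^{\mathrm u}$ be the $L^{\mathrm u}$-structure that interprets these unary symbols as constant maps with the old values. $\mathscr L$ *replaces $0$-ary symbols* if for every $\varphi\in\mathrm{Sent}(L)$ there is $\psi\in\mathrm{Sent}(L^{\mathrm u})$ with $\psi^{M^{\mathrm u}}=\varphi^M$ whenever $M$ and $M^{\mathrm u}$ are structures of $\mathscr L$. An $L$-structure $M$ is *RPC$_\Delta$-characterizable* in $\mathscr L$ (is RPC$_\Delta$) if there are a vocabulary $L'\supseteq L$, an $L'$-theory $T$ and a monadic predicate symbol $R\in L'$, discrete in every model of $T$, such that the $L$-structures isomorphic to $M$ are, up to isomorphism, exactly the structures $(N\restriction L)\restriction R^N$ for the models $N$ of $T$ in which the truth set of $R$ is nonempty and $L$-closed. A cardinal $\kappa$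 is *measurable* if $\kappa>\aleph_0$ and there is a nonprincipal $\kappa$-complete ultrafilter on a set of cardinality $\kappa$. **Theorem.** Let $\mathscr L$ be a regular logic for metric structures which is closed under discrete sums and replaces $0$-ary symbols. 1. If $\mathscr L$ is not $[\omega,\omega]$-compact, then every complete structure of $\mathscr L$ whose cardinality is less than every measurable cardinal is RPC$_\Delta$-characterizable in $\mathscr L$. 2. If there is no measurable cardinal and $\mathscr L$ is not $[\omega,\omega]$-compact, then every complete structure of $\mathscr L$ is RPC$_\Delta$-characterizable in $\mathscr L$. 3. The following are equivalent: (a) $\mathscr L$ is not $[\omega,\omega]$-compact; (b) the structure $(\omega,<)$, with the discrete metric, is RPC$_\Delta$ in $\mathscr L$; (c) every complete structure of $\mathscr L$ whose cardinality is less than every measurable cardinal is RPC$_\Delta$ in $\mathscr L$. -/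

import Mathlib

open FirstOrder Cardinal
open scoped unitInterval

universe u v

/-- Vocabularies: a set of `n`-ary function symbols and a set of `n`-ary predicate symbols for every
`n : ℕ`.  An inclusion of vocabularies, up to a renaming, is an injective language homomorphism.
The metric is a logical symbol: it belongs to every structure and is kept by every reduct. -/
abbrev Vocab := FirstOrder.Language.{u, u}


/-- A metric `L`-structure: a nonempty metric space of diameter at most `1`, with uniformly
continuous operations and uniformly continuous `[0,1]`-valued predicates. -/
structure MetricStr (L : Vocab.{u}) where
  carrier : Type u
  [metric : MetricSpace carrier]
  [nonempty : Nonempty carrier]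
  dist_le_one : ∀ x y : carrier, dist x y ≤ 1
  funMap : ∀ n, L.Functions n → (Fin n → carrier) → carrier
  relMap : ∀ n, L.Relations n → (Fin n → carrier) → I
  uc_fun : ∀ n (f : L.Functions n), UniformContinuous (funMap n f)
  uc_rel : ∀ n (r : L.Relations n), UniformContinuous (relMap n r)

namespace MetricStr

instance (L : Vocab.{u}) : CoeSort (MetricStr L) (Type u) := ⟨MetricStr.carrier⟩

attribute [instance] MetricStr.metric MetricStr.nonempty

variable {L L' : Vocab.{u}}

/-- Two structures are isomorphic: there is a bijection that preserves the metric and the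
interpretation of every symbol. -/
def Iso (M N : MetricStr L) : Prop :=
  ∃ e : M ≃ N, (∀ x y, dist (e x) (e y) = dist x y) ∧
    (∀ n (f : L.Functions n) x, N.funMap n f (fun k => e (x k)) = e (M.funMap n f x)) ∧
    (∀ n (r : L.Relations n) x, N.relMap n r (fun k => e (x k)) = M.relMap n r x)

/-- The reduct of an `L'`-structure along `ι : L →ᴸ L'`. -/
def reduct (M : MetricStr L') (ι : L →ᴸ L') : MetricStr L where
  carrier := M
  dist_le_one := M.dist_le_one
  funMap n f := M.funMap n (ι.onFunction f)
  relMap n r := M.relMap n (ι.onRelation r)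
  uc_fun n f := M.uc_fun n (ι.onFunction f)
  uc_rel n r := M.uc_rel n (ι.onRelation r)

/-- `A` is closed under the operations of `M`. -/
def ClosedSet (M : MetricStr L) (A : Set M) : Prop :=
  ∀ n (f : L.Functions n) (x : Fin n → M), (∀ k, x k ∈ A) → M.funMap n f x ∈ A

theorem uniformContinuous_pi_subtype (M : MetricStr L) (A : Set M) (n : ℕ) :
    UniformContinuous (fun (x : Fin n → A) (k : Fin n) => (x k : M)) :=
  uniformContinuous_pi.2 fun k =>
    uniformContinuous_subtype_val.comp (Pi.uniformContinuous_proj _ k)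

/-- The substructure with universe `A`. -/
def restrict (M : MetricStr L) (A : Set M) (hne : A.Nonempty) (hA : M.ClosedSet A) :
    MetricStr L where
  carrier := A
  nonempty := hne.to_subtype
  dist_le_one x y := M.dist_le_one x y
  funMap n f x := ⟨M.funMap n f (fun k => x k), hA n f _ (fun k => (x k).2)⟩
  relMap n r x := M.relMap n r (fun k => x k)
  uc_fun n f :=
    ((M.uc_fun n f).comp (M.uniformContinuous_pi_subtype A n)).subtype_mk _
  uc_rel n r := (M.uc_rel n r).comp (M.uniformContinuous_pi_subtype A n)

/-- Interpretation of the function symbols of `L[[α]]`, where the new constants name the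
elements `a i`. -/
def constFun (M : MetricStr L) {α : Type u} (a : α → M) :
    ∀ n, (L[[α]]).Functions n → (Fin n → M) → M
  | n, Sum.inl f => M.funMap n f
  | 0, Sum.inr c => fun _ => a c
  | _ + 1, Sum.inr c => PEmpty.elim c

theorem uniformContinuous_constFun (M : MetricStr L) {α : Type u} (a : α → M) (n : ℕ)
    (f : (L[[α]]).Functions n) : UniformContinuous (M.constFun a n f) := by
  match n, f with
  | n, Sum.inl f => cases n <;> exact M.uc_fun _ f
  | 0, Sum.inr c => exact uniformContinuous_const
  | _ + 1, Sum.inr c => exact PEmpty.elim c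

/-- The expansion `(M, a i)_{i : α}` of `M` by constants. -/
def withConst (M : MetricStr L) {α : Type u} (a : α → M) : MetricStr (L[[α]]) where
  carrier := M
  dist_le_one := M.dist_le_one
  funMap := M.constFun a
  relMap n r := Sum.elim (M.relMap n) Empty.elim r
  uc_fun n f := M.uniformContinuous_constFun a n f
  uc_rel n r := match r with
    | Sum.inl r => M.uc_rel n r
    | Sum.inr r => Empty.elim r

/-- The value of a closed term. -/
def termVal (M : MetricStr L) : FirstOrder.Language.Term L Empty → M
  | .var x => x.elim
  | .func f ts => M.funMap _ f (fun k => M.termVal (ts k))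

/-- The predicate symbol `r` is discrete in `M`. -/
def IsDiscrete (M : MetricStr L) {n : ℕ} (r : L.Relations n) : Prop :=
  ∀ x, M.relMap n r x = 0 ∨ M.relMap n r x = 1

/-- The truth set of a monadic predicate symbol. -/
def truthSet (M : MetricStr L) (r : L.Relations 1) : Set M :=
  {x | M.relMap 1 r ![x] = 1}

/-- The truth set of `R(·, b)`. -/
def slice (M : MetricStr L) (r : L.Relations 2) (b : M) : Set M :=
  {x | M.relMap 2 r ![x, b] = 1}

end MetricStr

/-- Symbols obtained by turning every `0`-ary symbol into a unary one and keeping the others. -/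
def unarySymbols (F : ℕ → Type u) : ℕ → Type u
  | 0 => PEmpty
  | 1 => F 1 ⊕ F 0
  | n + 2 => F (n + 2)

/-- A former `0`-ary symbol is interpreted as a constant unary map. -/
def unaryInterp {F : ℕ → Type u} {X Y : Type*} (J : ∀ n, F n → (Fin n → X) → Y) :
    ∀ n, unarySymbols F n → (Fin n → X) → Y
  | 0, s, _ => PEmpty.elim s
  | 1, Sum.inl s, x => J 1 s x
  | 1, Sum.inr s, _ => J 0 s Fin.elim0
  | n + 2, s, x => J (n + 2) s x

theorem uniformContinuous_unaryInterp {F : ℕ → Type u} {X Y : Type*} [UniformSpace X]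
    [UniformSpace Y] (J : ∀ n, F n → (Fin n → X) → Y) (hJ : ∀ n s, UniformContinuous (J n s))
    (n : ℕ) (s : unarySymbols F n) : UniformContinuous (unaryInterp J n s) := by
  match n, s with
  | 0, s => exact PEmpty.elim s
  | 1, Sum.inl s => exact hJ 1 s
  | 1, Sum.inr s => exact uniformContinuous_const
  | n + 2, s => exact hJ (n + 2) s

/-- The vocabulary obtained from `L` by turning every constant symbol into a unary function
symbol and every `0`-ary predicate symbol into a monadic predicate symbol. -/
def unaryVocab (L : Vocab.{u}) : Vocab.{u} :=
  ⟨unarySymbols L.Functions, unarySymbols L.Relations⟩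

/-- `M` with each `0`-ary symbol replaced by a unary symbol for the constant map of that value. -/
def MetricStr.unarize {L : Vocab.{u}} (M : MetricStr L) : MetricStr (unaryVocab L) where
  carrier := M
  dist_le_one := M.dist_le_one
  funMap := unaryInterp M.funMap
  relMap := unaryInterp M.relMap
  uc_fun := uniformContinuous_unaryInterp _ M.uc_fun
  uc_rel := uniformContinuous_unaryInterp _ M.uc_rel

/-- `K` is a discrete sum of the structures `M i`: its universe is the disjoint union of the
parts `M i`, different parts are at distance `1`, the symbols of the vocabulary `S i` of `M i`
have on the part `M i` the values that they have in the structure `M i`, and apart from that every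
symbol is constant on every product of parts. -/
structure DiscreteSum {L : Vocab.{u}} (K : MetricStr L) where
  ι : Type u
  part : K → ι
  dist_eq_one : ∀ x y, part x ≠ part y → dist x y = 1
  S : ι → Vocab.{u}
  incl : ∀ i, S i →ᴸ L
  incl_injective : ∀ i, (incl i).Injective
  M : ∀ i, MetricStr (S i)
  emb : ∀ i, M i → K
  isometry : ∀ i, Isometry (emb i)
  range_emb : ∀ i, Set.range (emb i) = part ⁻¹' {i}
  map_fun : ∀ i n (f : (S i).Functions n) x,
    K.funMap n ((incl i).onFunction f) (fun k => emb i (x k)) = emb i ((M i).funMap n f x)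
  map_rel : ∀ i n (r : (S i).Relations n) x,
    K.relMap n ((incl i).onRelation r) (fun k => emb i (x k)) = (M i).relMap n r x
  fun_const : ∀ n (f : L.Functions n) x y, (∀ k, part (x k) = part (y k)) →
    K.funMap n f x = K.funMap n f y ∨
      ∃ i, (∀ k, part (x k) = i) ∧ f ∈ Set.range ((incl i).onFunction (n := n))
  rel_const : ∀ n (r : L.Relations n) x y, (∀ k, part (x k) = part (y k)) →
    K.relMap n r x = K.relMap n r y ∨
      ∃ i, (∀ k, part (x k) = i) ∧ r ∈ Set.range ((incl i).onRelation (n := n))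

/-- The Łukasiewicz implication. -/
noncomputable def lukImp (x y : ℝ) : ℝ := min (1 - x + y) 1

/-- A logic for metric structures.  `Str` is its class of structures, `Sent L` its `L`-sentences
and `val M φ` the truth value of `φ` in `M`; the value is meaningful only if `Str M`.
An `L`-formula in one variable is a sentence in the vocabulary `L[[PUnit]]`, which has one new
constant symbol (the vocabulary `L` may itself contain constants for further variables). -/
structure MetricLogic where
  Str : ∀ {L : Vocab.{u}}, MetricStr L → Prop
  Sent : Vocab.{u} → Type v
  val : ∀ {L : Vocab.{u}}, MetricStr L → Sent L → I
  str_iso : ∀ {L : Vocab.{u}} {M N : MetricStr L}, M.Iso N → Str M → Str N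
  /-- closure under reducts and renamings -/
  str_reduct : ∀ {L L' : Vocab.{u}} (ι : L →ᴸ L') (M : MetricStr L'), ι.Injective →
    Str M → Str (M.reduct ι)
  /-- closure under expansions by constants -/
  str_const : ∀ {L : Vocab.{u}} (M : MetricStr L) {α : Type u} (a : α → M), Str M →
    Str (M.withConst a)
  val_iso : ∀ {L : Vocab.{u}} {M N : MetricStr L} (φ : Sent L), Str M → Str N →
    M.Iso N → val M φ = val N φ
  /-- sentences of a vocabulary are, up to renaming, sentences of every larger vocabulary
  (reduct property and renaming property) -/
  val_reduct : ∀ {L L' : Vocab.{u}} (ι : L →ᴸ L'), ι.Injective → ∀ φ : Sent L,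
    ∃ φ' : Sent L', ∀ M : MetricStr L', Str M → val M φ' = val (M.reduct ι) φ
  exists_rel : ∀ {L : Vocab.{u}} {n : ℕ} (r : L.Relations n) (t : Fin n → FirstOrder.Language.Term L Empty),
    ∃ φ : Sent L, ∀ M : MetricStr L, Str M → val M φ = M.relMap n r (fun k => M.termVal (t k))
  exists_dist : ∀ {L : Vocab.{u}} (s t : FirstOrder.Language.Term L Empty),
    ∃ φ : Sent L, ∀ M : MetricStr L, Str M → (val M φ : ℝ) = dist (M.termVal s) (M.termVal t)
  exists_imp : ∀ {L : Vocab.{u}} (φ ψ : Sent L),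
    ∃ χ : Sent L, ∀ M : MetricStr L, Str M → (val M χ : ℝ) = lukImp (val M φ) (val M ψ)
  exists_rat : ∀ (L : Vocab.{u}) (q : ℚ), 0 ≤ q → q ≤ 1 →
    ∃ φ : Sent L, ∀ M : MetricStr L, Str M → (val M φ : ℝ) = q
  exists_ex : ∀ {L : Vocab.{u}} (φ : Sent (L[[PUnit.{u + 1}]])),
    ∃ ψ : Sent L, ∀ M : MetricStr L, Str M →
      IsLUB (Set.range fun a : M => val (M.withConst fun _ : PUnit.{u + 1} => a) φ) (val M ψ)
  exists_all : ∀ {L : Vocab.{u}} (φ : Sent (L[[PUnit.{u + 1}]])),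
    ∃ ψ : Sent L, ∀ M : MetricStr L, Str M →
      IsGLB (Set.range fun a : M => val (M.withConst fun _ : PUnit.{u + 1} => a) φ) (val M ψ)

namespace MetricLogic

variable (ℒ : MetricLogic.{u, v}) {L : Vocab.{u}}

/-- `M` is a structure of the logic and a model of the theory `T`. -/
def Models (M : MetricStr L) (T : Set (ℒ.Sent L)) : Prop :=
  ℒ.Str M ∧ ∀ φ ∈ T, ℒ.val M φ = 1

def Satisfiable (T : Set (ℒ.Sent L)) : Prop :=
  ∃ M : MetricStr L, ℒ.Models M T

/-- `Δ` is a modulus of uniform continuity for `F`. -/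
def IsModulus {X Y : Type*} [PseudoMetricSpace X] [PseudoMetricSpace Y] (Δ : ℝ → ℝ)
    (F : X → Y) : Prop :=
  ∀ ε > 0, 0 < Δ ε ∧ ∀ x y, dist x y < Δ ε → dist (F x) (F y) ≤ ε

/-- A uniform family of theories: every function symbol and every predicate symbol has a modulus
of uniform continuity that is common to all models of all the theories of the family.
Tuples have the maximum metric. -/
def UniformFamily (𝒯 : Set (Set (ℒ.Sent L))) : Prop :=
  ∃ (Δ : ∀ n, L.Functions n → ℝ → ℝ) (E : ∀ n, L.Relations n → ℝ → ℝ),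
    ∀ T ∈ 𝒯, ∀ M : MetricStr L, ℒ.Models M T →
      (∀ n f, IsModulus (Δ n f) (M.funMap n f)) ∧ (∀ n r, IsModulus (E n r) (M.relMap n r))

/-- `[κ, μ]`-compactness. -/
def BracketCompact (κ μ : Cardinal.{v}) : Prop :=
  ∀ (L : Vocab.{u}) (𝒯 : Set (Set (ℒ.Sent L))), ℒ.UniformFamily 𝒯 → #𝒯 ≤ κ →
    (∀ 𝒯₀ ⊆ 𝒯, #𝒯₀ < μ → ℒ.Satisfiable (⋃₀ 𝒯₀)) → ℒ.Satisfiable (⋃₀ 𝒯)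

/-- The logic is regular: it permits relativization to definable families of predicates.
The formula `ψ` is the relativization `φ^{R(·, y)}`. -/
def IsRegular : Prop :=
  ∀ (L L' : Vocab.{u}) (ι : L →ᴸ L') (_ : ι.Injective) (R : L'.Relations 2)
    (_ : R ∉ Set.range (ι.onRelation (n := 2))) (φ : ℒ.Sent L),
    ∃ ψ : ℒ.Sent (L'[[PUnit.{u + 1}]]), ∀ M : MetricStr L', ℒ.Str M → M.IsDiscrete R →
      ∀ (hne : ∀ b : M, (M.slice R b).Nonempty)
        (hcl : ∀ b : M, (M.reduct ι).ClosedSet (M.slice R b)) (b : M),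
        ℒ.Str ((M.reduct ι).restrict (M.slice R b) (hne b) (hcl b)) ∧
          ℒ.val (M.withConst fun _ : PUnit.{u + 1} => b) ψ =
            ℒ.val ((M.reduct ι).restrict (M.slice R b) (hne b) (hcl b)) φ

/-- The class of structures is closed under discrete sums of its members and of single points,
provided that the predicates of the sum take no truth values except `0`, `1` and truth values that
predicates take in structures of the logic. -/
def ClosedUnderDiscreteSums : Prop :=
  ∀ (L : Vocab.{u}) (K : MetricStr L) (D : DiscreteSum K),
    (∀ i, ℒ.Str (D.M i) ∨ Subsingleton (D.M i)) →
    (∀ n (r : L.Relations n) x, K.relMap n r x = 0 ∨ K.relMap n r x = 1 ∨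
      ∃ (L₁ : Vocab.{u}) (N : MetricStr L₁), ℒ.Str N ∧
        ∃ m, ∃ (s : L₁.Relations m) (y : Fin m → N), N.relMap m s y = K.relMap n r x) →
    ℒ.Str K

/-- The `0`-ary symbols in a sentence can be replaced by unary symbols for constant maps. -/
def ReplacesNullarySymbols : Prop :=
  ∀ (L : Vocab.{u}) (φ : ℒ.Sent L), ∃ ψ : ℒ.Sent (unaryVocab L),
    ∀ M : MetricStr L, ℒ.Str M → ℒ.Str M.unarize → ℒ.val M.unarize ψ = ℒ.val M φ

/-- The class `𝒦` of `L`-structures is a relativized projective class (for theories). -/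
def IsRPCDeltaClass (𝒦 : MetricStr L → Prop) : Prop :=
  ∃ (L' : Vocab.{u}) (ι : L →ᴸ L') (_ : ι.Injective) (R : L'.Relations 1)
    (T : Set (ℒ.Sent L')),
    (∀ N : MetricStr L', ℒ.Models N T → N.IsDiscrete R) ∧
    ∀ A : MetricStr L, 𝒦 A ↔
      ∃ N : MetricStr L', ℒ.Models N T ∧
        ∃ (hne : (N.truthSet R).Nonempty) (hcl : (N.reduct ι).ClosedSet (N.truthSet R)),
          A.Iso ((N.reduct ι).restrict (N.truthSet R) hne hcl)

/-- The structure `M` is characterized up to isomorphism as a relativized projective class. -/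
def IsRPCDelta (M : MetricStr L) : Prop :=
  ℒ.IsRPCDeltaClass fun A => A.Iso M

end MetricLogic

/-- `κ` is a measurable cardinal: it is uncountable and carries a nonprincipal `κ`-complete
ultrafilter. -/
def IsMeasurableCardinal (κ : Cardinal.{u}) : Prop :=
  ℵ₀ < κ ∧ ∃ (α : Type u) (U : Ultrafilter α), #α = κ ∧
    CardinalInterFilter (U : Filter α) κ ∧ ∀ a : α, {a} ∉ U

/-- The vocabulary with one binary predicate symbol. -/
def ltVocab : Vocab.{u} :=
  ⟨fun _ => PEmpty, fun n => ULift.{u} (PLift (n = 2))⟩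

/-- The metric with all nonzero distances equal to `1`. -/
noncomputable abbrev discreteMetric (α : Type u) : MetricSpace α := by
  classical
  exact
  { dist := fun x y => if x = y then 0 else 1
    dist_self := fun x => if_pos rfl
    dist_comm := fun x y => by simp only [eq_comm]
    dist_triangle := fun x y z => by
      by_cases h1 : x = y
      · subst h1; simp
      · by_cases h3 : x = z
        · subst h3; simp [h1, Ne.symm h1]
        · simp only [h1, h3, if_false]
          split_ifs <;> norm_num
    eq_of_dist_eq_zero := fun {x y} h => by
      by_contra hne
      simp [hne] at h }

theorem discreteMetric_uniformContinuous {α : Type u} {Y : Type*} [UniformSpace Y] (n : ℕ)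
    (F : (Fin n → α) → Y) :
    @UniformContinuous _ _ (@Pi.uniformSpace _ _ fun _ =>
      (discreteMetric α).toPseudoMetricSpace.toUniformSpace) _ F := by
  let := discreteMetric α
  intro s hs
  refine Filter.mem_map.2 (Metric.mem_uniformity_dist.2 ⟨1, one_pos, fun {x y} hxy => ?_⟩)
  have hxy' : x = y := by
    funext k
    by_contra hne
    have h1 : dist (x k) (y k) = 1 := if_neg hne
    exact absurd (lt_of_le_of_lt (dist_le_pi_dist x y k) hxy) (by rw [h1]; exact lt_irrefl 1)
  subst hxy'
  exact refl_mem_uniformity (x := F x) hs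

/-- The structure `(ω, <)` with the discrete metric. -/
noncomputable def omegaLT : MetricStr ltVocab.{u} where
  carrier := ULift.{u} ℕ
  metric := discreteMetric _
  dist_le_one x y := by
    by_cases h : x = y
    · exact (if_pos h).trans_le zero_le_one
    · exact (if_neg h).le
  funMap _ f := PEmpty.elim f
  relMap n r x := if (x ⟨0, by have := r.down.down; omega⟩).down <
    (x ⟨1, by have := r.down.down; omega⟩).down then 1 else 0
  uc_fun _ f := PEmpty.elim f
  uc_rel n _ := discreteMetric_uniformContinuous n _

-- Suppose `[ω,ω]`-compactness fails. Enumerating a countable counterexample gives theories T_0,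
-- T_1, … and structures B_n with common moduli of continuity such that B_n satisfies T_0, …, T_n,
-- while no structure of the logic satisfies every T_n. Let M be a complete structure with universe
-- X. The coding structure is the discrete sum of M, of one isolated point for each a in X, and of
-- all the B_n. It has a constant for each point, a map `name` sending the point of a to a itself in
-- M, a discrete predicate for every subset of X, and for every h : X → ℕ a discrete relation whose
-- slice at the point of a is B_{h(a)}. Its theory records the Boolean laws for subsets of X, the
-- diagram of M on named elements, the density of names in the main part and, by relativization,
-- that the slice of h at b satisfies T_m whenever b lies in the extension of {a | m ≤ h a}.
--
-- In a model of this theory, an element x of the extension of X determines an ultrafilter on X: the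
-- sets whose extension contains x. No h tends to infinity along it, since the slice of h at x would
-- then satisfy every T_m. If this ultrafilter were nonprincipal, there would be a measurable
-- cardinal at most the cardinality of X (`exists_measurable_le_of_ultrafilter`). So if X is smaller
-- than every measurable cardinal, x is the value of a constant (`exists_eq_cst_of_axioms`). The
-- names then form a dense isometric copy of M in the main part, closed by completeness, so the main
-- part is isomorphic to M (`NameAxioms.iso`).
--
-- Subsets of X are coded on isolated points because a discrete predicate for an arbitrary subset of
-- M need not be uniformly continuous. Nullary symbols of the B_n are made unary because one
-- structure cannot give a nullary symbol a different value for each n.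
--
-- Conversely, if (ω,<) is characterizable, constants for an infinite descending sequence refute
-- compactness (`not_bracketCompact_of_isRPCDelta_omegaLT`). Finally, (ω,<) is itself a countable
-- complete structure of the logic, being a discrete sum of points.

universe w

/-! ### Isomorphisms and reducts of metric structures. -/

namespace MetricStr

variable {L L' : Vocab.{u}}

theorem Iso.refl (M : MetricStr L) : M.Iso M :=
  ⟨Equiv.refl M, fun _ _ => rfl, fun _ _ _ => rfl, fun _ _ _ => rfl⟩

theorem Iso.symm {M N : MetricStr L} (h : M.Iso N) : N.Iso M := by
  obtain ⟨e, hd, hf, hr⟩ := h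
  refine ⟨e.symm, fun x y => ?_, fun n f x => ?_, fun n r x => ?_⟩
  · rw [← hd]; simp
  · rw [Equiv.eq_symm_apply, ← hf]; simp
  · rw [← hr]; simp

theorem Iso.trans {M N P : MetricStr L} (h : M.Iso N) (h' : N.Iso P) : M.Iso P := by
  obtain ⟨e, hd, hf, hr⟩ := h
  obtain ⟨e', hd', hf', hr'⟩ := h'
  refine ⟨e.trans e', fun x y => ?_, fun n f x => ?_, fun n r x => ?_⟩
  · simp [hd, hd']
  · simp only [Equiv.trans_apply, ← hf]
    exact hf' n f fun k => e (x k)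
  · rw [← hr]
    exact hr' n r fun k => e (x k)

/-- Only the function symbols need an argument, as `constFun` matches on the arity. An equality
instead of an isomorphism allows rewriting inside truth values and closure hypotheses. -/
theorem reduct_withConst (M : MetricStr L) {α : Type u} (a : α → M) :
    (M.withConst a).reduct (L.lhomWithConstants α) = M := by
  obtain ⟨X, hd, F, R, hF, hR⟩ := M
  have h : (fun n f => constFun ⟨X, hd, F, R, hF, hR⟩ a n
      ((L.lhomWithConstants α).onFunction f)) = F := by
    funext n f; cases n <;> rfl
  simp only [reduct, withConst]
  congr 1

end MetricStr

namespace MetricLogic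

variable {ℒ : MetricLogic.{u, v}} {L L' : Vocab.{u}} {α β : Type u}

/-- The form of `val_reduct` used for every change of constant symbols: the smaller structure is
needed only up to isomorphism, and it then belongs to the logic automatically. -/
theorem exists_sent_of_iso (ι : L →ᴸ L') (hι : ι.Injective) (φ : ℒ.Sent L) :
    ∃ φ' : ℒ.Sent L', ∀ (M' : MetricStr L') (M : MetricStr L), ℒ.Str M' →
      M.Iso (M'.reduct ι) → ℒ.val M' φ' = ℒ.val M φ := by
  obtain ⟨φ', h⟩ := ℒ.val_reduct ι hι φ
  refine ⟨φ', fun M' M hM' hi => ?_⟩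
  have hs := ℒ.str_reduct ι M' hι hM'
  rw [h M' hM']
  exact ℒ.val_iso φ hs (ℒ.str_iso hi.symm hs) hi.symm

/-! ### Definable functions, closed conditions and axiomatizable classes -/

/-- The function `F`, in the variables `α`, is the value of a formula. -/
def Definable (ℒ : MetricLogic.{u, v}) (F : ∀ M : MetricStr L, (α → M) → ℝ) : Prop :=
  ∃ φ : ℒ.Sent (L[[α]]), ∀ M : MetricStr L, ℒ.Str M → ∀ a : α → M,
    (ℒ.val (M.withConst a) φ : ℝ) = F M a

/-- The function `τ`, in the variables `α`, is the value of a term. -/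
def TermDefinable (τ : ∀ M : MetricStr L, (α → M) → M) : Prop :=
  ∃ t : (L[[α]]).Term Empty, ∀ (M : MetricStr L) (a : α → M),
    (M.withConst a).termVal t = τ M a

/-- The condition `C`, in the variables `α`, says that a certain formula has the value `1`. -/
def Expressible (ℒ : MetricLogic.{u, v}) (C : ∀ M : MetricStr L, (α → M) → Prop) : Prop :=
  ∃ φ : ℒ.Sent (L[[α]]), ∀ M : MetricStr L, ℒ.Str M → ∀ a : α → M,
    ℒ.val (M.withConst a) φ = 1 ↔ C M a

/-- Among the structures of the logic, those in the class `C` are the models of some theory. -/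
def Axiomatizable (ℒ : MetricLogic.{u, v}) (C : MetricStr L → Prop) : Prop :=
  ∃ T : Set (ℒ.Sent L), ∀ M : MetricStr L, ℒ.Str M → ((∀ φ ∈ T, ℒ.val M φ = 1) ↔ C M)

theorem TermDefinable.var (i : α) :
    TermDefinable fun (M : MetricStr L) (a : α → M) => a i :=
  ⟨Language.Term.func (l := 0) (Sum.inr i : (L[[α]]).Functions 0) Fin.elim0, fun _ _ => rfl⟩

theorem TermDefinable.app {n : ℕ} (f : L.Functions n)
    {τ : Fin n → ∀ M : MetricStr L, (α → M) → M} (hτ : ∀ k, TermDefinable (τ k)) :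
    TermDefinable fun (M : MetricStr L) (a : α → M) => M.funMap n f fun k => τ k M a := by
  choose t ht using hτ
  refine ⟨.func (Sum.inl f : (L[[α]]).Functions n) t, fun M a => ?_⟩
  simp only [MetricStr.termVal, ht]
  cases n <;> rfl

theorem TermDefinable.app₀ (f : L.Functions 0) :
    TermDefinable fun (M : MetricStr L) (_ : α → M) => M.funMap 0 f ![] := by
  convert TermDefinable.app (α := α) f (τ := Fin.elim0) (fun k => k.elim0) using 4

theorem TermDefinable.app₁ (f : L.Functions 1) {τ : ∀ M : MetricStr L, (α → M) → M}
    (hτ : TermDefinable τ) :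
    TermDefinable fun (M : MetricStr L) (a : α → M) => M.funMap 1 f ![τ M a] := by
  convert TermDefinable.app (α := α) f (τ := fun _ => τ) (fun _ => hτ) using 4 with M a
  ext k; fin_cases k; rfl

theorem Definable.rel {n : ℕ} (r : L.Relations n)
    {τ : Fin n → ∀ M : MetricStr L, (α → M) → M} (hτ : ∀ k, TermDefinable (τ k)) :
    ℒ.Definable fun (M : MetricStr L) (a : α → M) => M.relMap n r fun k => τ k M a := by
  choose t ht using hτ
  obtain ⟨φ, h⟩ := ℒ.exists_rel (Sum.inl r : (L[[α]]).Relations n) t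
  refine ⟨φ, fun M hM a => ?_⟩
  rw [h _ (ℒ.str_const M a hM)]
  simp only [ht]
  rfl

theorem Definable.rel₁ (r : L.Relations 1) {τ : ∀ M : MetricStr L, (α → M) → M}
    (hτ : TermDefinable τ) :
    ℒ.Definable fun (M : MetricStr L) (a : α → M) => M.relMap 1 r ![τ M a] := by
  convert Definable.rel (ℒ := ℒ) r (τ := fun _ => τ) (fun _ => hτ) using 5 with M a
  ext k; fin_cases k; rfl

theorem Definable.rel₂ (r : L.Relations 2) {τ τ' : ∀ M : MetricStr L, (α → M) → M}
    (hτ : TermDefinable τ) (hτ' : TermDefinable τ') :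
    ℒ.Definable fun (M : MetricStr L) (a : α → M) => M.relMap 2 r ![τ M a, τ' M a] := by
  convert Definable.rel (ℒ := ℒ) r (τ := ![τ, τ'])
    (fun k => by fin_cases k; exacts [hτ, hτ']) using 5 with M a
  ext k; fin_cases k <;> rfl

theorem Definable.dist {τ τ' : ∀ M : MetricStr L, (α → M) → M}
    (hτ : TermDefinable τ) (hτ' : TermDefinable τ') :
    ℒ.Definable fun (M : MetricStr L) (a : α → M) => Dist.dist (τ M a) (τ' M a) := by
  obtain ⟨t, ht⟩ := hτ
  obtain ⟨s, hs⟩ := hτ'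
  obtain ⟨φ, h⟩ := ℒ.exists_dist t s
  refine ⟨φ, fun M hM a => ?_⟩
  rw [h _ (ℒ.str_const M a hM), ht, hs]
  rfl

theorem Definable.const (q : ℚ) (h0 : 0 ≤ q) (h1 : q ≤ 1) :
    ℒ.Definable fun (M : MetricStr L) (_ : α → M) => (q : ℝ) := by
  obtain ⟨φ, h⟩ := ℒ.exists_rat (L[[α]]) q h0 h1
  exact ⟨φ, fun M hM a => h _ (ℒ.str_const M a hM)⟩

theorem Definable.imp {F G : ∀ M : MetricStr L, (α → M) → ℝ}
    (hF : ℒ.Definable F) (hG : ℒ.Definable G) :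
    ℒ.Definable fun M a => lukImp (F M a) (G M a) := by
  obtain ⟨φ, hφ⟩ := hF
  obtain ⟨ψ, hψ⟩ := hG
  obtain ⟨χ, h⟩ := ℒ.exists_imp φ ψ
  exact ⟨χ, fun M hM a => by rw [h _ (ℒ.str_const M a hM), hφ M hM, hψ M hM]⟩

theorem Definable.mem {F : ∀ M : MetricStr L, (α → M) → ℝ} (hF : ℒ.Definable F)
    {M : MetricStr L} (hM : ℒ.Str M) (a : α → M) : 0 ≤ F M a ∧ F M a ≤ 1 := by
  obtain ⟨φ, hφ⟩ := hF
  rw [← hφ M hM]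
  exact (ℒ.val (M.withConst a) φ).2

theorem Definable.congr {F G : ∀ M : MetricStr L, (α → M) → ℝ} (hF : ℒ.Definable F)
    (h : ∀ M, ℒ.Str M → ∀ a, F M a = G M a) : ℒ.Definable G := by
  obtain ⟨φ, hφ⟩ := hF
  exact ⟨φ, fun M hM a => by rw [hφ M hM, h M hM]⟩

theorem Definable.not {F : ∀ M : MetricStr L, (α → M) → ℝ} (hF : ℒ.Definable F) :
    ℒ.Definable fun M a => 1 - F M a := by
  refine (hF.imp (Definable.const 0 le_rfl zero_le_one)).congr fun M hM a => ?_
  have := hF.mem hM a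
  simp [lukImp, this.1]

/-- In Łukasiewicz logic (F → G) → G has the value max F G. -/
theorem Definable.sup {F G : ∀ M : MetricStr L, (α → M) → ℝ}
    (hF : ℒ.Definable F) (hG : ℒ.Definable G) : ℒ.Definable fun M a => F M a ⊔ G M a := by
  refine ((hF.imp hG).imp hG).congr fun M hM a => ?_
  have h1 := hF.mem hM a
  have h2 := hG.mem hM a
  rcases le_total (F M a) (G M a) with h | h
  · have h3 : lukImp (F M a) (G M a) = 1 := min_eq_right (by linarith)
    rw [sup_eq_right.2 h, h3, lukImp, min_eq_left (by linarith)]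
    ring
  · have h3 : lukImp (F M a) (G M a) = 1 - F M a + G M a := min_eq_left (by linarith)
    rw [sup_eq_left.2 h, h3, lukImp, min_eq_left (by linarith)]
    ring

theorem Definable.eq_one {F : ∀ M : MetricStr L, (α → M) → ℝ} (hF : ℒ.Definable F) :
    ℒ.Expressible fun M a => F M a = 1 := by
  obtain ⟨φ, hφ⟩ := hF
  refine ⟨φ, fun M hM a => ?_⟩
  beta_reduce
  rw [← hφ M hM, ← Subtype.val_inj]
  rfl

theorem Expressible.congr {C D : ∀ M : MetricStr L, (α → M) → Prop} (hC : ℒ.Expressible C)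
    (h : ∀ M, ℒ.Str M → ∀ a, C M a ↔ D M a) : ℒ.Expressible D := by
  obtain ⟨φ, hφ⟩ := hC
  exact ⟨φ, fun M hM a => by rw [hφ M hM, h M hM]⟩

theorem Expressible.exists_definable {C : ∀ M : MetricStr L, (α → M) → Prop}
    (hC : ℒ.Expressible C) : ∃ F : ∀ M : MetricStr L, (α → M) → ℝ, ℒ.Definable F ∧
      ∀ M, ℒ.Str M → ∀ a, C M a ↔ F M a = 1 := by
  obtain ⟨φ, hφ⟩ := hC
  refine ⟨fun M a => ℒ.val (M.withConst a) φ, ⟨φ, fun M hM a => rfl⟩, fun M hM a => ?_⟩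
  rw [← hφ M hM, ← Subtype.val_inj]
  rfl

theorem Definable.le {F G : ∀ M : MetricStr L, (α → M) → ℝ}
    (hF : ℒ.Definable F) (hG : ℒ.Definable G) : ℒ.Expressible fun M a => F M a ≤ G M a := by
  refine (hF.imp hG).eq_one.congr fun M hM a => ?_
  rw [lukImp, min_eq_right_iff]
  constructor <;> intro h <;> linarith

/-- A maximum of two numbers of [0,1] is 1 only if one of them is. Expressible conditions are closed
conditions and cannot be negated, so later axioms are disjunctions in which "the predicate is 0"
plays the role of a negated premise. -/
theorem Expressible.or {C D : ∀ M : MetricStr L, (α → M) → Prop} (hC : ℒ.Expressible C)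
    (hD : ℒ.Expressible D) : ℒ.Expressible fun M a => C M a ∨ D M a := by
  obtain ⟨F, hF, hFC⟩ := hC.exists_definable
  obtain ⟨G, hG, hGD⟩ := hD.exists_definable
  refine (hF.sup hG).eq_one.congr fun M hM a => ?_
  rw [hFC M hM, hGD M hM]
  have h1 := hF.mem hM a
  have h2 := hG.mem hM a
  constructor
  · intro h
    rcases max_choice (F M a) (G M a) with h' | h'
    · exact Or.inl (h' ▸ h)
    · exact Or.inr (h' ▸ h)
  · rintro (h | h)
    · rw [h]; exact sup_eq_left.2 h2.2
    · rw [h]; exact sup_eq_right.2 h1.2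

theorem Definable.eq_zero {F : ∀ M : MetricStr L, (α → M) → ℝ} (hF : ℒ.Definable F) :
    ℒ.Expressible fun M a => F M a = 0 :=
  hF.not.eq_one.congr fun _ _ _ => by constructor <;> intro h <;> linarith

theorem Expressible.rel₁_eq_one (r : L.Relations 1) {τ : ∀ M : MetricStr L, (α → M) → M}
    (hτ : TermDefinable τ) : ℒ.Expressible fun M a => M.relMap 1 r ![τ M a] = 1 :=
  (Definable.rel₁ r hτ).eq_one.congr fun _ _ _ => by simp

theorem Expressible.rel₁_eq_zero (r : L.Relations 1) {τ : ∀ M : MetricStr L, (α → M) → M}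
    (hτ : TermDefinable τ) : ℒ.Expressible fun M a => M.relMap 1 r ![τ M a] = 0 :=
  (Definable.rel₁ r hτ).eq_zero.congr fun _ _ _ => by simp

theorem Expressible.rel₂_eq_one (r : L.Relations 2) {τ τ' : ∀ M : MetricStr L, (α → M) → M}
    (hτ : TermDefinable τ) (hτ' : TermDefinable τ') :
    ℒ.Expressible fun M a => M.relMap 2 r ![τ M a, τ' M a] = 1 :=
  (Definable.rel₂ r hτ hτ').eq_one.congr fun _ _ _ => by simp

theorem Expressible.rel₂_eq_zero (r : L.Relations 2) {τ τ' : ∀ M : MetricStr L, (α → M) → M}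
    (hτ : TermDefinable τ) (hτ' : TermDefinable τ') :
    ℒ.Expressible fun M a => M.relMap 2 r ![τ M a, τ' M a] = 0 :=
  (Definable.rel₂ r hτ hτ').eq_zero.congr fun _ _ _ => by simp

theorem Expressible.term_eq {τ τ' : ∀ M : MetricStr L, (α → M) → M}
    (hτ : TermDefinable τ) (hτ' : TermDefinable τ') : ℒ.Expressible fun M a => τ M a = τ' M a :=
  (Definable.dist hτ hτ').eq_zero.congr fun _ _ _ => dist_eq_zero

theorem Expressible.false : ℒ.Expressible fun (M : MetricStr L) (_ : α → M) => False :=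
  (Definable.const 0 le_rfl zero_le_one).eq_one.congr fun _ _ _ => by simp

theorem Expressible.exists_fin {n : ℕ} {C : Fin n → ∀ M : MetricStr L, (α → M) → Prop}
    (hC : ∀ k, ℒ.Expressible (C k)) : ℒ.Expressible fun M a => ∃ k, C k M a := by
  induction n with
  | zero => exact Expressible.false.congr fun _ _ _ => by simp
  | succ n ih =>
    exact ((hC 0).or (ih fun k => hC k.succ)).congr fun M _ a =>
      (Fin.exists_fin_succ (P := fun k => C k M a)).symm

/-- The symbols of `L[[Option α]]`, as symbols of `L[[α]]` with one more constant. -/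
def optionConstants : ∀ n, (L[[Option α]]).Functions n →
    ((L[[α]])[[PUnit.{u + 1}]]).Functions n
  | _, Sum.inl f => Sum.inl (Sum.inl f)
  | 0, Sum.inr c => Option.elim c (Sum.inr PUnit.unit) fun i => Sum.inl (Sum.inr i)
  | _ + 1, Sum.inr c => PEmpty.elim c

/-- The formulas in the variables `Option α` are formulas over `L[[α]]` in one variable. -/
theorem exists_sent_option (φ : ℒ.Sent (L[[Option α]])) :
    ∃ φ' : ℒ.Sent ((L[[α]])[[PUnit.{u + 1}]]), ∀ M : MetricStr L, ℒ.Str M →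
      ∀ (a : α → M) (y : M), ℒ.val ((M.withConst a).withConst fun _ : PUnit.{u + 1} => y) φ' =
        ℒ.val (M.withConst fun i : Option α => i.elim y a) φ := by
  let ι : L[[Option α]] →ᴸ (L[[α]])[[PUnit.{u + 1}]] :=
    { onFunction := fun {n} f => optionConstants n f
      onRelation := fun {n} r => Sum.elim (fun r => Sum.inl (Sum.inl r)) Empty.elim r }
  have hι : ι.Injective := by
    constructor
    · intro n f g h
      rcases n with _ | n
      · rcases f with f | _ | f <;> rcases g with g | _ | g <;> cases h <;> rfl
      · rcases f with f | f <;> rcases g with g | g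
        · cases h; rfl
        all_goals first | exact PEmpty.elim f | exact PEmpty.elim g
    · intro n r s h
      rcases r with r | r <;> rcases s with s | s
      · cases h; rfl
      all_goals first | exact Empty.elim r | exact Empty.elim s
  obtain ⟨φ', h⟩ := exists_sent_of_iso ι hι φ
  refine ⟨φ', fun M hM a y => h _ _ (ℒ.str_const _ _ (ℒ.str_const _ _ hM)) ?_⟩
  refine ⟨Equiv.refl _, fun _ _ => rfl, fun n f x => ?_, fun n r x => ?_⟩
  · rcases n with _ | n
    · rcases f with f | _ | f <;> rfl
    · rcases f with f | f
      · rfl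
      · exact PEmpty.elim f
  · rcases r with r | r
    · rfl
    · exact Empty.elim r

/-- The supremum of 1 - G over y is 1 exactly if the infimum of G is 0. The infimum need not be
attained, so existence is expressible only approximately. -/
theorem Definable.exists_approx {G : ∀ M : MetricStr L, (Option α → M) → ℝ}
    (hG : ℒ.Definable G) :
    ℒ.Expressible fun M a => ∀ ε > 0, ∃ y : M, G M (fun i => i.elim y a) < ε := by
  obtain ⟨φ, hφ⟩ := hG.not
  obtain ⟨φ', hφ'⟩ := exists_sent_option φ
  obtain ⟨ψ, hψ⟩ := ℒ.exists_ex φ'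
  refine ⟨ψ, fun M hM a => ?_⟩
  have hlub := hψ _ (ℒ.str_const M a hM)
  have hval : ∀ y : M,
      (ℒ.val ((M.withConst a).withConst fun _ : PUnit.{u + 1} => y) φ' : ℝ) =
        1 - G M (fun i => i.elim y a) := fun y => by rw [hφ' M hM, hφ M hM]
  constructor
  · intro h ε hε
    rw [h] at hlub
    by_contra! hc
    -- The maximum with 0 keeps the bound in the unit interval when ε > 1.
    have hub : (⟨max 0 (1 - ε), by simp, by simp [hε.le]⟩ : I) ∈ upperBounds (Set.range fun y : M =>
        ℒ.val ((M.withConst a).withConst fun _ : PUnit.{u + 1} => y) φ') := by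
      rintro _ ⟨y, rfl⟩
      rw [← Subtype.coe_le_coe]
      refine (hval y).le.trans ?_
      have := hc y
      exact le_max_of_le_right (by linarith)
    have h1 : (1 : ℝ) ≤ max 0 (1 - ε) := Subtype.coe_le_coe.2 (hlub.2 hub)
    rcases le_max_iff.1 h1 with h1 | h1 <;> linarith
  · intro h
    refine le_antisymm unitInterval.le_one' ?_
    rw [← Subtype.coe_le_coe]
    refine le_of_forall_pos_lt_add fun ε hε => ?_
    obtain ⟨y, hy⟩ := h ε hε
    have h1 : (ℒ.val ((M.withConst a).withConst fun _ : PUnit.{u + 1} => y) φ' : ℝ) ≤ _ :=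
      Subtype.coe_le_coe.2 (hlub.1 ⟨y, rfl⟩)
    rw [hval] at h1
    simp only [Set.Icc.coe_one]
    linarith

/-- Induction on the number of variables: an infimum of values in [0,1] is 1 iff all of them are.
The cases of an equivalence and of no variables are pure renamings of constants. -/
theorem exists_sent_forall [Finite α] (φ : ℒ.Sent (L[[α]])) :
    ∃ ψ : ℒ.Sent L, ∀ M : MetricStr L, ℒ.Str M →
      (ℒ.val M ψ = 1 ↔ ∀ a : α → M, ℒ.val (M.withConst a) φ = 1) := by
  revert φ
  induction α using Finite.induction_empty_option with
  | @of_equiv α β e ih =>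
    intro φ
    let ι : L[[β]] →ᴸ L[[α]] := L.lhomWithConstantsMap e.symm
    have hι : ι.Injective := by
      constructor
      · intro n f g h
        rcases n with _ | n
        · rcases f with f | f <;> rcases g with g | g
          · exact congrArg Sum.inl (Sum.inl.inj h)
          · cases h
          · cases h
          · exact congrArg Sum.inr (e.symm.injective (Sum.inr.inj h))
        · rcases f with f | f <;> rcases g with g | g
          · exact congrArg Sum.inl (Sum.inl.inj h)
          all_goals first | exact PEmpty.elim f | exact PEmpty.elim g
      · intro n r s h
        rcases r with r | r <;> rcases s with s | s
        · exact congrArg Sum.inl (Sum.inl.inj h)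
        all_goals first | exact Empty.elim r | exact Empty.elim s
    obtain ⟨φ', h⟩ := exists_sent_of_iso ι hι φ
    obtain ⟨ψ, hψ⟩ := ih φ'
    refine ⟨ψ, fun M hM => (hψ M hM).trans ?_⟩
    have key : ∀ a : α → M,
        ℒ.val (M.withConst a) φ' = ℒ.val (M.withConst fun i => a (e.symm i)) φ := by
      refine fun a => h _ _ (ℒ.str_const _ _ hM) ⟨Equiv.refl _, fun _ _ => rfl, ?_, ?_⟩
      · intro n f x
        rcases n with _ | n
        · rcases f with f | f <;> rfl
        · rcases f with f | f
          · rfl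
          · exact PEmpty.elim f
      · intro n r x
        rcases r with r | r
        · rfl
        · exact Empty.elim r
    refine ⟨fun H a => ?_, fun H a => (key a).trans (H _)⟩
    have := (key fun i => a (e i)).symm.trans (H _)
    simpa using this
  | h_empty =>
    intro φ
    let ι : L[[PEmpty.{u + 1}]] →ᴸ L :=
      { onFunction := fun {n} f => Sum.elim id (fun c => by cases n <;> exact PEmpty.elim c) f
        onRelation := fun {n} r => Sum.elim id Empty.elim r }
    have hι : ι.Injective := by
      constructor
      · intro n f g h
        rcases f with f | f <;> rcases g with g | g
        · exact congrArg Sum.inl h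
        all_goals cases n <;> first | exact PEmpty.elim f | exact PEmpty.elim g
      · intro n r s h
        rcases r with r | r <;> rcases s with s | s
        · exact congrArg Sum.inl h
        all_goals first | exact Empty.elim r | exact Empty.elim s
    obtain ⟨φ', h⟩ := exists_sent_of_iso ι hι φ
    refine ⟨φ', fun M hM => ?_⟩
    have key : ∀ a : PEmpty → M, ℒ.val M φ' = ℒ.val (M.withConst a) φ := by
      refine fun a => h _ _ hM ⟨Equiv.refl _, fun _ _ => rfl, ?_, ?_⟩
      · intro n f x
        rcases f with f | f
        · cases n <;> rfl
        · cases n <;> exact PEmpty.elim f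
      · intro n r x
        rcases r with r | r
        · rfl
        · exact Empty.elim r
    exact ⟨fun H a => (key a).symm.trans H, fun H => (key PEmpty.elim).trans (H _)⟩
  | @h_option α _ ih =>
    intro φ
    obtain ⟨φ', hφ'⟩ := exists_sent_option φ
    obtain ⟨χ, hχ⟩ := ℒ.exists_all φ'
    obtain ⟨ψ, hψ⟩ := ih χ
    refine ⟨ψ, fun M hM => (hψ M hM).trans ?_⟩
    have key : ∀ a : α → M, ℒ.val (M.withConst a) χ = 1 ↔
        ∀ y : M, ℒ.val (M.withConst fun i : Option α => i.elim y a) φ = 1 := by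
      intro a
      have hglb := hχ _ (ℒ.str_const M a hM)
      constructor
      · intro h y
        refine le_antisymm unitInterval.le_one' ?_
        rw [← hφ' M hM, ← h]
        exact hglb.1 ⟨y, rfl⟩
      · intro h
        refine le_antisymm unitInterval.le_one' (hglb.2 ?_)
        rintro _ ⟨y, rfl⟩
        exact ((hφ' M hM a y).trans (h y)).ge
    simp only [key]
    refine ⟨fun H a => ?_, fun H a y => H _⟩
    convert H (fun i => a (some i)) (a none) using 3
    ext i; cases i <;> rfl

/-- Arbitrary conjunctions come from unions of theories; the index may be large, such as all subsets
of X or all maps X → ℕ. -/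
theorem Axiomatizable.forall {κ : Sort*} {C : κ → MetricStr L → Prop}
    (h : ∀ i, ℒ.Axiomatizable (C i)) : ℒ.Axiomatizable fun M => ∀ i, C i M := by
  choose T hT using h
  refine ⟨⋃ i, T i, fun M hM => ?_⟩
  simp only [Set.mem_iUnion, ← hT _ M hM]
  exact ⟨fun H i φ hφ => H φ ⟨i, hφ⟩, fun H φ ⟨i, hφ⟩ => H i φ hφ⟩

theorem Axiomatizable.and {C D : MetricStr L → Prop} (hC : ℒ.Axiomatizable C)
    (hD : ℒ.Axiomatizable D) : ℒ.Axiomatizable fun M => C M ∧ D M := by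
  obtain ⟨T, hT⟩ := hC
  obtain ⟨S, hS⟩ := hD
  refine ⟨T ∪ S, fun M hM => ?_⟩
  beta_reduce
  rw [← hT M hM, ← hS M hM]
  exact ⟨fun H => ⟨fun φ h => H φ (Or.inl h), fun φ h => H φ (Or.inr h)⟩,
    fun H φ h => h.elim (H.1 φ) (H.2 φ)⟩

theorem Axiomatizable.congr {C D : MetricStr L → Prop} (hC : ℒ.Axiomatizable C)
    (h : ∀ M, ℒ.Str M → (C M ↔ D M)) : ℒ.Axiomatizable D := by
  obtain ⟨T, hT⟩ := hC
  exact ⟨T, fun M hM => (hT M hM).trans (h M hM)⟩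

theorem Axiomatizable.theory (T : Set (ℒ.Sent L)) :
    ℒ.Axiomatizable fun M => ∀ φ ∈ T, ℒ.val M φ = 1 :=
  ⟨T, fun _ _ => Iff.rfl⟩

theorem Axiomatizable.reduct (ι : L →ᴸ L') (hι : ι.Injective) {C : MetricStr L → Prop}
    (hC : ℒ.Axiomatizable C) : ℒ.Axiomatizable fun M : MetricStr L' => C (M.reduct ι) := by
  obtain ⟨T, hT⟩ := hC
  choose t ht using ℒ.val_reduct ι hι
  refine ⟨t '' T, fun M hM => ?_⟩
  beta_reduce
  rw [← hT _ (ℒ.str_reduct ι M hι hM), Set.forall_mem_image]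
  simp only [ht _ M hM]

theorem Expressible.forall [Finite α] {C : ∀ M : MetricStr L, (α → M) → Prop}
    (hC : ℒ.Expressible C) : ℒ.Axiomatizable fun M => ∀ a, C M a := by
  obtain ⟨φ, hφ⟩ := hC
  obtain ⟨ψ, hψ⟩ := exists_sent_forall φ
  refine ⟨{ψ}, fun M hM => ?_⟩
  simp only [Set.mem_singleton_iff, forall_eq, hψ M hM, hφ M hM]

/-- Only rational constants are available, so a real value is pinned down by all rational bounds on
either side of it. -/
theorem Definable.axiomatizable_eq [Finite α] {F : ∀ M : MetricStr L, (α → M) → ℝ}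
    (hF : ℒ.Definable F) (r : ℝ) : ℒ.Axiomatizable fun M => ∀ a, F M a = r := by
  by_cases hr : 0 ≤ r ∧ r ≤ 1
  · have h1 : ∀ q : {q : ℚ // (0 ≤ q ∧ q ≤ 1) ∧ r ≤ q},
        ℒ.Axiomatizable fun M : MetricStr L => ∀ a, F M a ≤ q := fun q =>
      (hF.le (Definable.const q q.2.1.1 q.2.1.2)).forall
    have h2 : ∀ q : {q : ℚ // (0 ≤ q ∧ q ≤ 1) ∧ q ≤ r},
        ℒ.Axiomatizable fun M : MetricStr L => ∀ a, q ≤ F M a := fun q =>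
      ((Definable.const q q.2.1.1 q.2.1.2).le hF).forall
    refine ((Axiomatizable.forall h1).and (Axiomatizable.forall h2)).congr fun M hM => ?_
    constructor
    · rintro ⟨H1, H2⟩ a
      have hm := hF.mem hM a
      refine le_antisymm ?_ ?_
      · by_contra! hlt
        obtain ⟨q, hq1, hq2⟩ := exists_rat_btwn hlt
        -- A rational between `r` and the value lies in [0,1] because both ends do, so it is an
        -- admissible constant.
        have := H1 ⟨q, ⟨by exact_mod_cast hr.1.trans hq1.le, by exact_mod_cast hq2.le.trans hm.2⟩,
          hq1.le⟩ a
        exact absurd this (not_le.2 hq2)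
      · by_contra! hlt
        obtain ⟨q, hq1, hq2⟩ := exists_rat_btwn hlt
        have := H2 ⟨q, ⟨by exact_mod_cast hm.1.trans hq1.le, by exact_mod_cast hq2.le.trans hr.2⟩,
          hq2.le⟩ a
        exact absurd this (not_le.2 hq1)
    · intro H
      simp only [H]
      exact ⟨fun q _ => q.2.2, fun q _ => q.2.2⟩
  -- For `r` outside [0,1] the class is empty, since structures are nonempty and values lie in
  -- [0,1].
  · refine (Expressible.false (α := PEmpty)).forall.congr fun M hM => ?_
    simp only [forall_const, false_iff, not_forall]
    exact ⟨fun _ => Classical.arbitrary M, fun h => hr (h ▸ hF.mem hM _)⟩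

end MetricLogic

/-! ### Axiomatizing moduli of continuity; (ω,<) and the failure of compactness. -/

namespace MetricLogic

variable {ℒ : MetricLogic.{u, v}} {L L' : Vocab.{u}} {α β : Type u}

/-- `δ ε` is a modulus of uniform continuity at `ε`, for rational `ε ∈ (0, 1)`. -/
def RatModulus {n : ℕ} {X Y : Type*} [PseudoMetricSpace X] [PseudoMetricSpace Y] (δ : ℚ → ℚ)
    (F : (Fin n → X) → Y) : Prop :=
  ∀ ε : {ε : ℚ // 0 < ε ∧ ε < 1}, ∀ x y,
    (∃ k, (δ ε : ℝ) ≤ dist (x k) (y k)) ∨ dist (F x) (F y) ≤ ε.1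

/-- Rational moduli in (0,1] can be written with the constant sentences of the logic; the junk value
1 for `ε ≤ 0` keeps the bounds valid everywhere. -/
theorem exists_ratModulus {n : ℕ} {X Y : Type*} [PseudoMetricSpace X] [PseudoMetricSpace Y]
    {F : (Fin n → X) → Y} (hF : UniformContinuous F) :
    ∃ δ : ℚ → ℚ, (∀ ε, 0 < δ ε ∧ δ ε ≤ 1) ∧ RatModulus δ F := by
  have key : ∀ ε : ℚ, ∃ δ : ℚ, (0 < δ ∧ δ ≤ 1) ∧ (0 < ε → ∀ x y : Fin n → X,
      (∃ k, (δ : ℝ) ≤ dist (x k) (y k)) ∨ dist (F x) (F y) ≤ ε) := by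
    intro ε
    by_cases hε : 0 < ε
    · obtain ⟨d, hd, h⟩ := Metric.uniformContinuous_iff.1 hF ε (by exact_mod_cast hε)
      obtain ⟨q, hq0, hq⟩ := exists_rat_btwn (lt_min hd one_pos)
      refine ⟨q, ⟨by exact_mod_cast hq0, by exact_mod_cast (hq.le.trans (min_le_right _ _))⟩,
        fun _ x y => ?_⟩
      by_contra! hc
      refine absurd (h (a := x) (b := y) ?_) (not_lt.2 hc.2.le)
      exact ((dist_pi_lt_iff hq0).2 hc.1).trans_le (hq.le.trans (min_le_left _ _))
    · exact ⟨1, ⟨one_pos, le_rfl⟩, fun h => absurd h hε⟩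
  choose δ h1 h2 using key
  exact ⟨δ, h1, fun ε => h2 ε ε.2.1⟩

/-- A real `ε` is handled by a rational below `min ε 1`. The function `Δ` depends on `δ` alone, so
it serves all models at once. -/
theorem exists_isModulus {δ : ℚ → ℚ} (hδ : ∀ ε, 0 < δ ε) : ∃ Δ : ℝ → ℝ,
    ∀ (n : ℕ) (X : Type u) (Y : Type w) [PseudoMetricSpace X] [PseudoMetricSpace Y]
      (F : (Fin n → X) → Y),
      RatModulus δ F → IsModulus Δ F := by
  have key : ∀ ε : ℝ, ∃ q : ℚ, 0 < ε → 0 < q ∧ q < 1 ∧ (q : ℝ) < ε := by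
    intro ε
    by_cases hε : 0 < ε
    · obtain ⟨q, hq0, hq⟩ := exists_rat_btwn (lt_min hε one_pos)
      exact ⟨q, fun _ => ⟨by exact_mod_cast hq0,
        by exact_mod_cast (hq.trans_le (min_le_right _ _)), hq.trans_le (min_le_left _ _)⟩⟩
    · exact ⟨0, fun h => absurd h hε⟩
  choose q hq using key
  refine ⟨fun ε => δ (q ε), fun n X Y _ _ F hF ε hε => ⟨Rat.cast_pos.2 (hδ _), fun x y hxy => ?_⟩⟩
  rcases hF ⟨q ε, (hq ε hε).1, (hq ε hε).2.1⟩ x y with ⟨k, hk⟩ | h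
  · exact absurd ((dist_le_pi_dist x y k).trans_lt hxy) (not_lt.2 hk)
  · exact h.trans (hq ε hε).2.2.le

theorem axiomatizable_ratModulus_fun {n : ℕ} (f : L.Functions n) {δ : ℚ → ℚ}
    (hδ : ∀ ε, 0 < δ ε ∧ δ ε ≤ 1) :
    ℒ.Axiomatizable fun M : MetricStr L => RatModulus δ (M.funMap n f) := by
  refine Axiomatizable.forall fun ε => ?_
  have hk : ∀ k : Fin n, ℒ.Expressible fun (M : MetricStr L) (a : ULift.{u} (Fin n ⊕ Fin n) → M) =>
      (δ ε : ℝ) ≤ dist (a ⟨Sum.inl k⟩) (a ⟨Sum.inr k⟩) := fun k =>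
    (Definable.const _ (hδ ε).1.le (hδ ε).2).le
      (Definable.dist (TermDefinable.var _) (TermDefinable.var _))
  have hd : ℒ.Expressible fun (M : MetricStr L) (a : ULift.{u} (Fin n ⊕ Fin n) → M) =>
      dist (M.funMap n f fun k => a ⟨Sum.inl k⟩) (M.funMap n f fun k => a ⟨Sum.inr k⟩) ≤ ε.1 :=
    (Definable.dist (TermDefinable.app f fun k => TermDefinable.var _)
      (TermDefinable.app f fun k => TermDefinable.var _)).le
      (Definable.const _ ε.2.1.le ε.2.2.le)
  exact ((Expressible.exists_fin hk).or hd).forall.congr fun M _ =>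
    ⟨fun H x y => H fun i => Sum.elim x y i.down, fun H a => H _ _⟩

theorem axiomatizable_ratModulus_rel {n : ℕ} (r : L.Relations n) {δ : ℚ → ℚ}
    (hδ : ∀ ε, 0 < δ ε ∧ δ ε ≤ 1) :
    ℒ.Axiomatizable fun M : MetricStr L => RatModulus δ (M.relMap n r) := by
  refine Axiomatizable.forall fun ε => ?_
  have hk : ∀ k : Fin n, ℒ.Expressible fun (M : MetricStr L) (a : ULift.{u} (Fin n ⊕ Fin n) → M) =>
      (δ ε : ℝ) ≤ dist (a ⟨Sum.inl k⟩) (a ⟨Sum.inr k⟩) := fun k =>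
    (Definable.const _ (hδ ε).1.le (hδ ε).2).le
      (Definable.dist (TermDefinable.var _) (TermDefinable.var _))
  -- The inequality says that the first value exceeds the second by at most ε; exchanging the two
  -- tuples gives the absolute value.
  have hd : ℒ.Expressible fun (M : MetricStr L) (a : ULift.{u} (Fin n ⊕ Fin n) → M) =>
      ((1 - ε.1 : ℚ) : ℝ) ≤ lukImp (M.relMap n r fun k => a ⟨Sum.inl k⟩)
        (M.relMap n r fun k => a ⟨Sum.inr k⟩) :=
    (Definable.const _ (sub_nonneg.2 ε.2.2.le) (sub_le_self _ ε.2.1.le)).le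
      ((Definable.rel r fun k => TermDefinable.var _).imp
        (Definable.rel r fun k => TermDefinable.var _))
  have hε : (0 : ℝ) < ε.1 := by exact_mod_cast ε.2.1
  refine ((Expressible.exists_fin hk).or hd).forall.congr fun M _ =>
    ⟨fun H x y => or_iff_not_imp_left.2 fun hn => ?_, fun H a => ?_⟩
  · have h1 := (H fun i => Sum.elim x y i.down).resolve_left hn
    have h2 := (H fun i => Sum.elim y x i.down).resolve_left (by simpa [dist_comm] using hn)
    simp only [Sum.elim_inl, Sum.elim_inr, lukImp, le_min_iff] at h1 h2
    push_cast at h1 h2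
    rw [Subtype.dist_eq, Real.dist_eq, abs_le]
    constructor <;> linarith
  · refine (H (fun k => a ⟨Sum.inl k⟩) (fun k => a ⟨Sum.inr k⟩)).imp_right fun h => ?_
    rw [Subtype.dist_eq, Real.dist_eq, abs_le] at h
    push_cast
    exact le_min (by linarith) (by linarith)

/-- Any theory with a model can be strengthened so that this model is kept, while all symbols have
common moduli of uniform continuity. -/
theorem exists_uniform_extension (N : MetricStr L) :
    ∃ C : MetricStr L → Prop, ℒ.Axiomatizable C ∧ C N ∧
      ∃ (Δ : ∀ n, L.Functions n → ℝ → ℝ) (E : ∀ n, L.Relations n → ℝ → ℝ),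
        ∀ M : MetricStr L, C M →
          (∀ n f, IsModulus (Δ n f) (M.funMap n f)) ∧
            (∀ n r, IsModulus (E n r) (M.relMap n r)) := by
  choose δ hδ hN using fun (n : ℕ) (f : L.Functions n) => exists_ratModulus (N.uc_fun n f)
  choose δ' hδ' hN' using fun (n : ℕ) (r : L.Relations n) => exists_ratModulus (N.uc_rel n r)
  choose Δ hΔ using fun n f => exists_isModulus.{u, u} fun ε => (hδ n f ε).1
  choose E hE using fun n r => exists_isModulus.{u, 0} fun ε => (hδ' n r ε).1
  exact ⟨fun M => (∀ n f, RatModulus (δ n f) (M.funMap n f)) ∧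
      ∀ n r, RatModulus (δ' n r) (M.relMap n r),
    (Axiomatizable.forall fun n => Axiomatizable.forall fun f =>
      axiomatizable_ratModulus_fun f (hδ n f)).and
    (Axiomatizable.forall fun n => Axiomatizable.forall fun r =>
      axiomatizable_ratModulus_rel r (hδ' n r)),
    ⟨hN, hN'⟩, Δ, E, fun M hM => ⟨fun n f => hΔ n f _ _ _ _ (hM.1 n f),
      fun n r => hE n r _ _ _ _ (hM.2 n r)⟩⟩

/-- Add constants d_0, d_1, … and let the n-th theory say that d_0 > d_1 > … > d_{n+1} in the coded
copy of ω. Finitely many of these theories hold in one expansion of a fixed model; all together they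
contradict well-foundedness. -/
theorem not_bracketCompact_of_isRPCDelta_omegaLT (h : ℒ.IsRPCDelta omegaLT.{u}) :
    ¬ ℒ.BracketCompact ℵ₀ ℵ₀ := by
  intro hcomp
  obtain ⟨L', ι, hι, Q, T, hQ, hT⟩ := h
  obtain ⟨N, hN, hne, hcl, e, hed, hef, her⟩ := (hT omegaLT).1 (MetricStr.Iso.refl _)
  -- Compactness applies only to uniform families, so the moduli of the model `N` are added to the
  -- axioms.
  obtain ⟨C, hCax, hCN, Δ, E, hmod⟩ := exists_uniform_extension (ℒ := ℒ) N
  let lt : (ltVocab.{u}).Relations 2 := ⟨⟨rfl⟩⟩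
  let J := ULift.{u} ℕ
  let d : ℕ → ∀ M : MetricStr (L'[[J]]), (PEmpty.{u + 1} → M) → M := fun i M _ =>
    M.funMap 0 (Sum.inr ⟨i⟩ : (L'[[J]]).Functions 0) ![]
  have hd : ∀ i, TermDefinable (d i) := fun i => TermDefinable.app₀ _
  let W : ℕ → MetricStr (L'[[J]]) → Prop := fun n M =>
    ((∀ φ ∈ T, ℒ.val (M.reduct (L'.lhomWithConstants J)) φ = 1) ∧
      C (M.reduct (L'.lhomWithConstants J))) ∧
    ∀ i : {i // i ≤ n}, ∀ a : PEmpty → M,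
      M.relMap 1 (Sum.inl Q : (L'[[J]]).Relations 1) ![d i M a] = 1 ∧
      M.relMap 2 (Sum.inl (ι.onRelation lt) : (L'[[J]]).Relations 2)
        ![d (i + 1) M a, d i M a] = 1
  have hW : ∀ n, ℒ.Axiomatizable (W n) := by
    intro n
    have hinj := Language.lhomWithConstants_injective (L := L') J
    refine (((Axiomatizable.theory T).reduct _ hinj).and (hCax.reduct _ hinj)).and ?_
    refine Axiomatizable.forall fun i => ?_
    refine ((Expressible.rel₁_eq_one (Sum.inl Q : (L'[[J]]).Relations 1) (hd i)).forall.and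
      (Expressible.rel₂_eq_one (Sum.inl (ι.onRelation lt) : (L'[[J]]).Relations 2)
        (hd (i + 1)) (hd i)).forall).congr fun M hM => ?_
    exact forall_and.symm
  choose S hS using hW
  have hsat : ∀ n, ∃ M, ℒ.Str M ∧ W n M := by
    intro n
    -- The constants name n+1, n, …, 0; truncated subtraction makes the later ones 0, about which
    -- the n-th theory says nothing.
    obtain ⟨c, hc⟩ : ∃ c : J → N, ∀ j, c j =
        Subtype.val (p := (· ∈ N.truthSet Q)) (e ⟨n + 1 - j.down⟩) := ⟨_, fun _ => rfl⟩
    have hred := N.reduct_withConst c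
    refine ⟨N.withConst c, ℒ.str_const _ _ hN.1, ⟨?_, ?_⟩, fun i a => ⟨?_, ?_⟩⟩
    · rw [hred]; exact hN.2
    · rw [hred]; exact hCN
    · show N.relMap 1 Q ![c ⟨i⟩] = 1
      rw [hc]
      exact Subtype.prop (p := (· ∈ N.truthSet Q)) (e ⟨n + 1 - i.1⟩)
    show N.relMap 2 (ι.onRelation lt) ![c ⟨i + 1⟩, c ⟨i⟩] = 1
    rw [hc, hc]
    have := her 2 lt ![⟨n + 1 - (i.1 + 1)⟩, ⟨n + 1 - i.1⟩]
    refine Eq.trans ?_ (this.trans (if_pos ?_))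
    · show N.relMap 2 (ι.onRelation lt) _ = N.relMap 2 (ι.onRelation lt) _
      congr 1
      ext k
      fin_cases k <;> rfl
    · have := i.2
      show n + 1 - (i.1 + 1) < n + 1 - i.1
      omega
  have hmono : ∀ m n, m ≤ n → ∀ M, W n M → W m M := fun m n hmn M h =>
    ⟨h.1, fun i => h.2 ⟨i.1, i.2.trans hmn⟩⟩
  have hsatS : ℒ.Satisfiable (⋃₀ Set.range S) → False := by
    rintro ⟨M, hM, hMS⟩
    have hMW : ∀ n, W n M := fun n => (hS n M hM).1 fun φ hφ => hMS φ ⟨_, ⟨n, rfl⟩, hφ⟩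
    have hs := ℒ.str_reduct (L'.lhomWithConstants J) M
      (Language.lhomWithConstants_injective (L := L') J) hM
    have hM' : ℒ.Models (M.reduct (L'.lhomWithConstants J)) T := ⟨hs, (hMW 0).1.1⟩
    set M' := M.reduct (L'.lhomWithConstants J) with hM'def
    let c : ℕ → M' := fun i => d i M PEmpty.elim
    have hc : ∀ i, c i ∈ M'.truthSet Q := fun i => ((hMW i).2 ⟨i, le_rfl⟩ PEmpty.elim).1
    have hc' : ∀ i, M'.relMap 2 (ι.onRelation lt) ![c (i + 1), c i] = 1 := fun i =>
      ((hMW i).2 ⟨i, le_rfl⟩ PEmpty.elim).2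
    obtain ⟨e', -, -, her'⟩ := (hT _).2 ⟨M', hM', ⟨c 0, hc 0⟩, fun n f => PEmpty.elim f,
      MetricStr.Iso.refl _⟩
    have hlt : ∀ i, (e' ⟨c (i + 1), hc _⟩).down < (e' ⟨c i, hc _⟩).down := by
      intro i
      have h1 := her' 2 lt ![⟨c (i + 1), hc _⟩, ⟨c i, hc _⟩]
      have h2 : ((M'.reduct ι).restrict (M'.truthSet Q) ⟨c 0, hc 0⟩
          fun n f => PEmpty.elim f).relMap 2 lt ![⟨c (i + 1), hc _⟩, ⟨c i, hc _⟩] = 1 := by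
        rw [← hc' i]
        show M'.relMap 2 (ι.onRelation lt) _ = M'.relMap 2 (ι.onRelation lt) _
        congr 1
        ext k
        fin_cases k <;> rfl
      rw [h2] at h1
      by_contra hcon
      exact zero_ne_one ((if_neg hcon).symm.trans h1)
    exact (RelEmbedding.natGT (r := (· < ·)) (fun i => (e' ⟨c i, hc _⟩).down) hlt).not_wellFounded
      (wellFounded_lt (α := ℕ))
  refine hsatS (hcomp (L'[[J]]) (Set.range S) ?_ ?_ ?_)
  · refine ⟨fun n f => Sum.elim (Δ n) (fun _ _ => 1) f, fun n r => Sum.elim (E n) Empty.elim r, ?_⟩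
    rintro _ ⟨n, rfl⟩ M hM
    have := hmod _ ((hS n M hM.1).1 hM.2).1.2
    constructor
    · rintro n (f | f)
      · exact this.1 n f
      · cases n with
        -- A constant has a one-point domain, so any modulus works.
        | zero => exact fun ε hε => ⟨one_pos, fun x y _ => by
            rw [Subsingleton.elim x y, dist_self]; exact hε.le⟩
        | succ n => exact PEmpty.elim f
    · rintro n (r | r)
      · exact this.2 n r
      · exact Empty.elim r
  · exact Cardinal.mk_le_aleph0_iff.2 (Set.countable_range S).to_subtype
  · intro 𝒯₀ hsub hfin
    have hfin' : 𝒯₀.Finite := Cardinal.lt_aleph0_iff_set_finite.1 hfin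
    -- Finitely many theories have indices bounded by some n, and `W n` implies the earlier
    -- conditions.
    have : ∃ n, ∀ T₀ ∈ 𝒯₀, ∃ m ≤ n, S m = T₀ := by
      choose! g hg using fun T₀ (hT₀ : T₀ ∈ 𝒯₀) => Set.mem_range.1 (hsub hT₀)
      obtain ⟨n, hn⟩ := (hfin'.image g).bddAbove
      exact ⟨n, fun T₀ h => ⟨g T₀, hn ⟨T₀, h, rfl⟩, hg T₀ h⟩⟩
    obtain ⟨n, hn⟩ := this
    obtain ⟨M, hM, hMW⟩ := hsat n
    refine ⟨M, hM, ?_⟩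
    rintro φ ⟨T₀, hT₀, hφ⟩
    obtain ⟨m, hm, rfl⟩ := hn T₀ hT₀
    exact (hS m M hM).2 (hmono m n hm M hMW) φ hφ

end MetricLogic

/-! ### Construction of discrete sums. -/

/-- Data for a discrete sum of the structures `M i`: the vocabularies of the summands are embedded
into `L`, and a symbol that does not act inside a summand is given by a map defined on tuples of
indices. -/
structure SumData (L : Vocab.{u}) where
  Idx : Type u
  [nonempty : Nonempty Idx]
  S : Idx → Vocab.{u}
  M : ∀ i, MetricStr (S i)
  incl : ∀ i, S i →ᴸ L
  incl_injective : ∀ i, (incl i).Injective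
  -- The empty tuple lies in every part, so a nullary symbol may act in at most one summand.
  fun_zero : ∀ i j (f : (S i).Functions 0) (g : (S j).Functions 0),
    (incl i).onFunction f = (incl j).onFunction g → i = j
  rel_zero : ∀ i j (f : (S i).Relations 0) (g : (S j).Relations 0),
    (incl i).onRelation f = (incl j).onRelation g → i = j
  defFun : ∀ n, L.Functions n → (Fin n → Idx) → Σ i, M i
  defRel : ∀ n, L.Relations n → (Fin n → Idx) → I
  -- Infinitely many summands may share a symbol, so a common modulus has to be required.
  uniform_fun : ∀ n (s : L.Functions n), ∀ ε > (0 : ℝ), ∃ δ > 0, ∀ i (f : (S i).Functions n),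
    (incl i).onFunction f = s →
      ∀ x y, dist x y < δ → dist ((M i).funMap n f x) ((M i).funMap n f y) ≤ ε
  uniform_rel : ∀ n (s : L.Relations n), ∀ ε > (0 : ℝ), ∃ δ > 0, ∀ i (f : (S i).Relations n),
    (incl i).onRelation f = s →
      ∀ x y, dist x y < δ → dist ((M i).relMap n f x) ((M i).relMap n f y) ≤ ε

namespace SumData

variable {L : Vocab.{u}} (D : SumData L)

attribute [instance] SumData.nonempty

def Carrier : Type u := Σ i, D.M i

variable {D}

def emb (i : D.Idx) (x : D.M i) : D.Carrier := ⟨i, x⟩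

def part (p : D.Carrier) : D.Idx := p.1

@[simp] theorem part_emb (i : D.Idx) (x : D.M i) : part (emb i x) = i := rfl

theorem exists_eq_emb {p : D.Carrier} {i : D.Idx} (h : part p = i) : ∃ x, p = emb i x := by
  subst h
  exact ⟨p.2, rfl⟩

theorem exists_emb (p : D.Carrier) : ∃ i x, p = emb i x :=
  ⟨_, _, rfl⟩

theorem emb_injective (i : D.Idx) : Function.Injective (emb (D := D) i) :=
  fun _ _ h => eq_of_heq (Sigma.mk.inj h).2

open Classical in
noncomputable def sumDist (p q : D.Carrier) : ℝ :=
  if h : part p = part q then dist (h ▸ p.2 : D.M (part q)) q.2 else 1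

theorem sumDist_emb (i : D.Idx) (x y : D.M i) : sumDist (emb i x) (emb i y) = dist x y :=
  dif_pos rfl

theorem sumDist_of_ne {p q : D.Carrier} (h : part p ≠ part q) : sumDist p q = 1 :=
  dif_neg h

theorem sumDist_nonneg (p q : D.Carrier) : 0 ≤ sumDist p q := by
  by_cases h : part p = part q
  · obtain ⟨i, y, rfl⟩ := exists_emb q
    obtain ⟨x, rfl⟩ := exists_eq_emb (i := i) h
    exact (sumDist_emb _ x y).symm ▸ dist_nonneg
  · rw [sumDist_of_ne h]
    exact zero_le_one

theorem sumDist_le_one (p q : D.Carrier) : sumDist p q ≤ 1 := by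
  by_cases h : part p = part q
  · obtain ⟨i, y, rfl⟩ := exists_emb q
    obtain ⟨x, rfl⟩ := exists_eq_emb (i := i) h
    exact (sumDist_emb _ x y).symm ▸ (D.M _).dist_le_one _ _
  · rw [sumDist_of_ne h]

/-- Summands have diameter at most 1. If p, q, r are not in one part, then p, q or q, r are at
distance 1, which already bounds the distance of p and r. -/
noncomputable instance : MetricSpace D.Carrier where
  dist := sumDist
  dist_self p := (sumDist_emb p.1 p.2 p.2).trans (dist_self _)
  dist_comm p q := by
    by_cases h : part p = part q
    · obtain ⟨i, y, rfl⟩ := exists_emb q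
      obtain ⟨x, rfl⟩ := exists_eq_emb (i := i) h
      exact (sumDist_emb _ x y).trans ((dist_comm x y).trans (sumDist_emb _ y x).symm)
    · exact (sumDist_of_ne h).trans (sumDist_of_ne (Ne.symm h)).symm
  dist_triangle p q r := by
    have hpq := sumDist_nonneg p q
    have hqr := sumDist_nonneg q r
    have hpr := sumDist_le_one p r
    by_cases h1 : part p = part q
    · by_cases h2 : part q = part r
      · obtain ⟨i, z, rfl⟩ := exists_emb r
        obtain ⟨y, rfl⟩ := exists_eq_emb (i := i) h2
        obtain ⟨x, rfl⟩ := exists_eq_emb (i := i) h1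
        have := dist_triangle x y z
        rw [← sumDist_emb, ← sumDist_emb, ← sumDist_emb] at this
        exact this
      · rw [sumDist_of_ne h2]
        linarith
    · rw [sumDist_of_ne h1]
      linarith
  eq_of_dist_eq_zero {p q} h := by
    change sumDist p q = 0 at h
    by_cases h1 : part p = part q
    · obtain ⟨i, y, rfl⟩ := exists_emb q
      obtain ⟨x, rfl⟩ := exists_eq_emb (i := i) h1
      have h2 : dist x y = 0 := (sumDist_emb _ x y).symm.trans h
      rw [eq_of_dist_eq_zero h2]
    · rw [sumDist_of_ne h1] at h
      exact absurd h one_ne_zero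

instance : Nonempty D.Carrier :=
  let i := Classical.arbitrary D.Idx
  ⟨emb i (Classical.arbitrary (D.M i))⟩

theorem dist_emb (i : D.Idx) (x y : D.M i) : dist (emb i x) (emb i y) = dist x y :=
  sumDist_emb i x y

theorem dist_of_ne {p q : D.Carrier} (h : part p ≠ part q) : dist p q = 1 :=
  sumDist_of_ne h

open Classical in
/-- The map that acts as `g i` inside the part `i` if `P i` holds, and is otherwise given by a map
`c` of the parts. -/
noncomputable def glue {n : ℕ} {Y : Type*} (P : D.Idx → Prop)
    (g : ∀ i, P i → (Fin n → D.M i) → Y) (c : (Fin n → D.Idx) → Y) (x : Fin n → D.Carrier) : Y :=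
  if h : ∃ i, P i ∧ ∀ k, part (x k) = i then
    g h.choose h.choose_spec.1 fun k => (exists_eq_emb (h.choose_spec.2 k)).choose
  else c fun k => part (x k)

variable {n : ℕ} {Y : Type*} {P : D.Idx → Prop}
    {g : ∀ i, P i → (Fin n → D.M i) → Y} {c : (Fin n → D.Idx) → Y}

theorem glue_emb (hP : n = 0 → ∀ i j, P i → P j → i = j) {i : D.Idx} (hi : P i)
    (x : Fin n → D.M i) : glue P g c (fun k => emb i (x k)) = g i hi x := by
  have h : ∃ j, P j ∧ ∀ k : Fin n, part (emb i (x k)) = j := ⟨i, hi, fun _ => rfl⟩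
  -- The chosen part is read off the first entry of the tuple; for the empty tuple uniqueness is the
  -- hypothesis `hP`.
  have hji : h.choose = i := by
    rcases n with _ | n
    · exact hP rfl _ _ h.choose_spec.1 hi
    · exact (h.choose_spec.2 0).symm
  rw [glue, dif_pos h]
  generalize_proofs h1 h2
  revert h1 h2
  generalize h.choose = j at hji
  subst hji
  intro h1 h2
  congr 1
  funext k
  exact (emb_injective _ (h2 k).choose_spec).symm

theorem glue_of_not (x : Fin n → D.Carrier) (h : ∀ i, P i → ¬ ∀ k, part (x k) = i) :
    glue P g c x = c fun k => part (x k) :=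
  dif_neg fun ⟨i, hi, hx⟩ => h i hi hx

theorem glue_const {x y : Fin n → D.Carrier} (h : ∀ k, part (x k) = part (y k)) :
    glue P g c x = glue P g c y ∨ ∃ i, (∀ k, part (x k) = i) ∧ P i := by
  by_cases hi : ∃ i, (∀ k, part (x k) = i) ∧ P i
  · exact Or.inr hi
  · left
    rw [glue_of_not x fun i h1 h2 => hi ⟨i, h2, h1⟩,
      glue_of_not y fun i h1 h2 => hi ⟨i, fun k => (h k).trans (h2 k), h1⟩]
    simp only [h]

theorem part_eq_of_dist_lt {x y : Fin n → D.Carrier} (h : dist x y < 1) (k : Fin n) :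
    part (x k) = part (y k) := by
  by_contra hne
  exact absurd ((dist_le_pi_dist x y k).trans_lt h) (by rw [dist_of_ne hne]; exact lt_irrefl 1)

theorem dist_pi_emb (i : D.Idx) (x y : Fin n → D.M i) :
    dist (fun k => emb i (x k)) (fun k => emb i (y k)) = dist x y := by
  simp only [dist_pi_def, nndist_dist, dist_emb]

/-- Tuples at distance less than 1 run through the same parts. They lie in one summand where the
common modulus applies, or the map takes equal values on them. -/
theorem uniformContinuous_glue [PseudoMetricSpace Y] (hP : n = 0 → ∀ i j, P i → P j → i = j)
    (hg : ∀ ε > (0 : ℝ), ∃ δ > 0, ∀ i hi x y, dist x y < δ → dist (g i hi x) (g i hi y) ≤ ε) :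
    UniformContinuous (glue P g c) := by
  refine Metric.uniformContinuous_iff.2 fun ε hε => ?_
  obtain ⟨δ, hδ, h⟩ := hg (ε / 2) (half_pos hε)
  refine ⟨min δ 1, lt_min hδ one_pos, fun {x y} hxy => ?_⟩
  have hpart := part_eq_of_dist_lt (hxy.trans_le (min_le_right _ _))
  by_cases hi : ∃ i, (∀ k, part (x k) = i) ∧ P i
  · obtain ⟨i, hx, hi⟩ := hi
    choose x' hx' using fun k => exists_eq_emb (hx k)
    choose y' hy' using fun k => exists_eq_emb ((hpart k).symm.trans (hx k))
    obtain rfl : x = _ := funext hx'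
    obtain rfl : y = _ := funext hy'
    rw [dist_pi_emb] at hxy
    rw [glue_emb hP hi, glue_emb hP hi]
    exact (h i hi _ _ (hxy.trans_le (min_le_left _ _))).trans_lt (half_lt_self hε)
  · rw [(glue_const hpart).resolve_right hi, dist_self]
    exact hε

variable (D)

/-- The discrete sum. -/
noncomputable def sum : MetricStr L where
  carrier := D.Carrier
  dist_le_one := sumDist_le_one
  funMap n s := glue (fun i => ∃ f, (D.incl i).onFunction f = s)
    (fun i hi x => emb i ((D.M i).funMap n hi.choose x)) (D.defFun n s)
  relMap n s := glue (fun i => ∃ f, (D.incl i).onRelation f = s)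
    (fun i hi x => (D.M i).relMap n hi.choose x) (D.defRel n s)
  uc_fun n s := by
    refine uniformContinuous_glue ?_ fun ε hε => ?_
    · rintro rfl i j ⟨f, hf⟩ ⟨g, hg⟩
      exact D.fun_zero i j f g (hf.trans hg.symm)
    · obtain ⟨δ, hδ, h⟩ := D.uniform_fun n s ε hε
      refine ⟨δ, hδ, fun i hi x y hxy => ?_⟩
      rw [dist_emb]
      exact h i _ hi.choose_spec x y hxy
  uc_rel n s := by
    refine uniformContinuous_glue ?_ fun ε hε => ?_
    · rintro rfl i j ⟨f, hf⟩ ⟨g, hg⟩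
      exact D.rel_zero i j f g (hf.trans hg.symm)
    · obtain ⟨δ, hδ, h⟩ := D.uniform_rel n s ε hε
      exact ⟨δ, hδ, fun i hi x y hxy => h i _ hi.choose_spec x y hxy⟩

theorem sum_funMap {n : ℕ} (s : L.Functions n) (x : Fin n → D.Carrier) :
    D.sum.funMap n s x = glue (fun i => ∃ f, (D.incl i).onFunction f = s)
      (fun i hi x => emb i ((D.M i).funMap n hi.choose x)) (D.defFun n s) x := rfl

theorem sum_relMap {n : ℕ} (s : L.Relations n) (x : Fin n → D.Carrier) :
    D.sum.relMap n s x = glue (fun i => ∃ f, (D.incl i).onRelation f = s)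
      (fun i hi x => (D.M i).relMap n hi.choose x) (D.defRel n s) x := rfl

theorem sum_funMap_emb (i : D.Idx) {n : ℕ} (f : (D.S i).Functions n) (x : Fin n → D.M i) :
    D.sum.funMap n ((D.incl i).onFunction f) (fun k => emb i (x k)) =
      emb i ((D.M i).funMap n f x) := by
  have hi : ∃ f', (D.incl i).onFunction f' = (D.incl i).onFunction f := ⟨f, rfl⟩
  rw [sum_funMap]
  refine (glue_emb (P := fun j => ∃ f', (D.incl j).onFunction f' = (D.incl i).onFunction f)
    ?_ hi x).trans ?_
  · rintro rfl i j ⟨f, hf⟩ ⟨g, hg⟩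
    exact D.fun_zero i j f g (hf.trans hg.symm)
  · rw [(D.incl_injective i).onFunction hi.choose_spec]

theorem sum_relMap_emb (i : D.Idx) {n : ℕ} (f : (D.S i).Relations n) (x : Fin n → D.M i) :
    D.sum.relMap n ((D.incl i).onRelation f) (fun k => emb i (x k)) = (D.M i).relMap n f x := by
  have hi : ∃ f', (D.incl i).onRelation f' = (D.incl i).onRelation f := ⟨f, rfl⟩
  rw [sum_relMap]
  refine (glue_emb (P := fun j => ∃ f', (D.incl j).onRelation f' = (D.incl i).onRelation f)
    ?_ hi x).trans ?_
  · rintro rfl i j ⟨f, hf⟩ ⟨g, hg⟩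
    exact D.rel_zero i j f g (hf.trans hg.symm)
  · rw [(D.incl_injective i).onRelation hi.choose_spec]

theorem sum_funMap_of_not_mem {n : ℕ} (s : L.Functions n)
    (h : ∀ i, s ∉ Set.range ((D.incl i).onFunction (n := n))) (x : Fin n → D.sum) :
    D.sum.funMap n s x = D.defFun n s fun k => part (x k) :=
  (D.sum_funMap s x).trans (glue_of_not x fun i hi => (h i hi).elim)

theorem sum_relMap_of_not_mem {n : ℕ} (s : L.Relations n)
    (h : ∀ i, s ∉ Set.range ((D.incl i).onRelation (n := n))) (x : Fin n → D.sum) :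
    D.sum.relMap n s x = D.defRel n s fun k => part (x k) :=
  (D.sum_relMap s x).trans (glue_of_not x fun i hi => (h i hi).elim)

theorem sum_fun_const {n : ℕ} (f : L.Functions n) {x y : Fin n → D.Carrier}
    (h : ∀ k, part (x k) = part (y k)) : D.sum.funMap n f x = D.sum.funMap n f y ∨
      ∃ i, (∀ k, part (x k) = i) ∧ f ∈ Set.range ((D.incl i).onFunction (n := n)) := by
  rw [sum_funMap, sum_funMap]
  exact glue_const (P := fun i => ∃ f', (D.incl i).onFunction f' = f) h

theorem sum_rel_const {n : ℕ} (r : L.Relations n) {x y : Fin n → D.Carrier}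
    (h : ∀ k, part (x k) = part (y k)) : D.sum.relMap n r x = D.sum.relMap n r y ∨
      ∃ i, (∀ k, part (x k) = i) ∧ r ∈ Set.range ((D.incl i).onRelation (n := n)) := by
  rw [sum_relMap, sum_relMap]
  exact glue_const (P := fun i => ∃ r', (D.incl i).onRelation r' = r) h

noncomputable def discreteSum : DiscreteSum D.sum where
  ι := D.Idx
  part := part
  dist_eq_one _ _ h := dist_of_ne h
  S := D.S
  incl := D.incl
  incl_injective := D.incl_injective
  M := D.M
  emb := emb
  isometry i := Isometry.of_dist_eq (dist_emb i)
  range_emb i := by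
    ext p
    exact ⟨by rintro ⟨x, rfl⟩; rfl, fun h => (exists_eq_emb h).imp fun x hx => hx.symm⟩
  map_fun i n f x := D.sum_funMap_emb i f x
  map_rel i n r x := D.sum_relMap_emb i r x
  fun_const n f x y h := D.sum_fun_const f h
  rel_const n r x y h := D.sum_rel_const r h

/-- Truth values inside a summand must come from a structure of the logic. A one-point summand is
not assumed to be one, and therefore must have no predicate symbols; all other values are 0 or 1. -/
theorem str_sum {ℒ : MetricLogic.{u, v}} (hsum : ℒ.ClosedUnderDiscreteSums)
    (hM : ∀ i, ℒ.Str (D.M i) ∨ Subsingleton (D.M i) ∧ ∀ n, IsEmpty ((D.S i).Relations n))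
    (hrel : ∀ n r p, D.defRel n r p = 0 ∨ D.defRel n r p = 1) : ℒ.Str D.sum := by
  refine hsum L D.sum D.discreteSum (fun i => (hM i).imp_right And.left) fun n r x => ?_
  by_cases h : ∃ i, (∃ f, (D.incl i).onRelation f = r) ∧ ∀ k, part (x k) = i
  · obtain ⟨i, ⟨f, rfl⟩, hx⟩ := h
    choose x' hx' using fun k => exists_eq_emb (hx k)
    obtain rfl : x = _ := funext hx'
    refine Or.inr (Or.inr ⟨D.S i, D.M i,
      (hM i).resolve_right fun h => (h.2 n).false f, n, f, x', ?_⟩)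
    exact (D.sum_relMap_emb i f x').symm
  · have : D.sum.relMap n r x = D.defRel n r fun k => part (x k) :=
      (D.sum_relMap r x).trans (glue_of_not x fun i h1 h2 => h ⟨i, h1, h2⟩)
    rw [this]
    exact (hrel n r _).imp_right Or.inl

/-- Keeping `A` variable lets truth sets and slices be used directly, once they are identified with
a summand. -/
theorem iso_restrict_sum (i : D.Idx) {A : Set D.sum} (hA : A = Set.range (emb (D := D) i))
    (hne : A.Nonempty) (hcl : (D.sum.reduct (D.incl i)).ClosedSet A) :
    (D.M i).Iso ((D.sum.reduct (D.incl i)).restrict A hne hcl) := by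
  refine ⟨Equiv.ofBijective (fun x => (⟨emb i x, hA ▸ ⟨x, rfl⟩⟩ : A)) ⟨?_, ?_⟩, dist_emb i, ?_, ?_⟩
  · exact fun x y h => emb_injective i (congrArg Subtype.val h)
  · rintro ⟨p, hp⟩
    obtain ⟨x, rfl⟩ : p ∈ Set.range (emb (D := D) i) := hA ▸ hp
    exact ⟨x, rfl⟩
  · exact fun n f x => Subtype.ext (D.sum_funMap_emb i f x)
  · exact fun n f x => D.sum_relMap_emb i f x

end SumData

/-- The vocabulary without symbols. -/
def emptyVocab : Vocab.{u} := ⟨fun _ => PEmpty, fun _ => PEmpty⟩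

/-- The structure with one element, in the vocabulary without symbols. -/
noncomputable def pointStr : MetricStr emptyVocab.{u} where
  carrier := PUnit.{u + 1}
  metric := discreteMetric _
  dist_le_one x y := by
    rw [Subsingleton.elim x y]
    exact (if_pos rfl).trans_le zero_le_one
  funMap _ f := PEmpty.elim f
  relMap _ r := PEmpty.elim r
  uc_fun _ f := PEmpty.elim f
  uc_rel _ r := PEmpty.elim r

instance instSubsingletonPointStr : Subsingleton pointStr.{u} :=
  inferInstanceAs (Subsingleton PUnit.{u + 1})

/-! ### Structures that belong to the logic by closure under discrete sums. -/

namespace MetricLogic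

variable {ℒ : MetricLogic.{u, v}} {L L' : Vocab.{u}}

/-- It is the discrete sum of its points: any predicate is constant on products of singletons, and <
takes only the values 0 and 1. -/
theorem str_omegaLT (hsum : ℒ.ClosedUnderDiscreteSums) : ℒ.Str omegaLT.{u} := by
  refine hsum _ _
    { ι := omegaLT.{u}
      part := id
      dist_eq_one := fun x y h => if_neg h
      S := fun _ => emptyVocab
      incl := fun _ => ⟨fun {_} f => PEmpty.elim f, fun {_} r => PEmpty.elim r⟩
      incl_injective := fun _ => ⟨fun {_} f => PEmpty.elim f, fun {_} r => PEmpty.elim r⟩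
      M := fun _ => pointStr
      emb := fun i _ => i
      isometry := fun i => isometry_subsingleton
      range_emb := fun i => by ext x; simp [eq_comm]
      map_fun := fun i n f => PEmpty.elim f
      map_rel := fun i n f => PEmpty.elim f
      fun_const := fun n f => PEmpty.elim f
      rel_const := fun n r x y h => Or.inl (congrArg _ (funext h)) }
    (fun i => Or.inr (instSubsingletonPointStr)) fun n r x => ?_
  have : omegaLT.relMap n r x = 0 ∨ omegaLT.relMap n r x = 1 := (ite_eq_or_eq _ _ _).symm
  exact this.imp_right Or.inl

/-- A structure belongs to the logic if a reduct does that omits only symbols which are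
interpreted by constant maps. -/
theorem str_of_reduct (hsum : ℒ.ClosedUnderDiscreteSums) (ι : L →ᴸ L') (hι : ι.Injective)
    (K : MetricStr L') (hK : ℒ.Str (K.reduct ι))
    (hf : ∀ n (f : L'.Functions n), f ∈ Set.range (ι.onFunction (n := n)) ∨
      ∀ x y, K.funMap n f x = K.funMap n f y)
    (hr : ∀ n (r : L'.Relations n), r ∈ Set.range (ι.onRelation (n := n)) ∨
      ∀ x y, K.relMap n r x = K.relMap n r y)
    (hval : ∀ n (r : L'.Relations n) x, ∃ (L₁ : Vocab.{u}) (N : MetricStr L₁), ℒ.Str N ∧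
        ∃ m, ∃ (s : L₁.Relations m) (y : Fin m → N), N.relMap m s y = K.relMap n r x) :
    ℒ.Str K := by
  -- The sum has a single summand, the reduct; the omitted symbols are constant on its powers.
  refine hsum _ _
    { ι := PUnit
      part := fun _ => PUnit.unit
      dist_eq_one := fun x y h => absurd rfl h
      S := fun _ => L
      incl := fun _ => ι
      incl_injective := fun _ => hι
      M := fun _ => K.reduct ι
      emb := fun _ => id
      isometry := fun _ => isometry_id
      range_emb := fun i => by ext x; exact ⟨fun _ => rfl, fun _ => ⟨x, rfl⟩⟩
      map_fun := fun _ _ _ _ => rfl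
      map_rel := fun _ _ _ _ => rfl
      fun_const := fun n f x y _ => (hf n f).symm.imp (fun h => h x y)
        fun h => ⟨PUnit.unit, fun _ => rfl, h⟩
      rel_const := fun n f x y _ => (hr n f).symm.imp (fun h => h x y)
        fun h => ⟨PUnit.unit, fun _ => rfl, h⟩ }
    (fun _ => Or.inl hK) fun n r x => Or.inr (Or.inr (hval n r x))

end MetricLogic

/-! ### Nullary symbols -/

def positiveSymbols (F : ℕ → Type u) : ℕ → Type u
  | 0 => PEmpty
  | n + 1 => F (n + 1)

def positiveSymbols.val {F : ℕ → Type u} : ∀ {n}, positiveSymbols F n → F n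
  | 0, s => PEmpty.elim s
  | _ + 1, s => s

def positiveSymbols.toUnary {F : ℕ → Type u} : ∀ {n}, positiveSymbols F n → unarySymbols F n
  | 0, s => PEmpty.elim s
  | 1, s => Sum.inl s
  | _ + 2, s => s

theorem positiveSymbols.val_injective {F : ℕ → Type u} {n : ℕ} :
    Function.Injective (positiveSymbols.val (F := F) (n := n)) := by
  rcases n with _ | n
  · exact fun s => PEmpty.elim s
  · exact fun s t h => h

theorem positiveSymbols.toUnary_injective {F : ℕ → Type u} {n : ℕ} :
    Function.Injective (positiveSymbols.toUnary (F := F) (n := n)) := by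
  rcases n with _ | _ | n
  · exact fun s => PEmpty.elim s
  · exact fun s t h => Sum.inl.inj h
  · exact fun s t h => h

/-- The vocabulary of the symbols of positive arity. -/
def positiveVocab (L : Vocab.{u}) : Vocab.{u} :=
  ⟨positiveSymbols L.Functions, positiveSymbols L.Relations⟩

def positiveIncl (L : Vocab.{u}) : positiveVocab L →ᴸ L :=
  ⟨fun {_} f => positiveSymbols.val f, fun {_} r => positiveSymbols.val r⟩

def positiveToUnary (L : Vocab.{u}) : positiveVocab L →ᴸ unaryVocab L :=
  ⟨fun {_} f => positiveSymbols.toUnary f, fun {_} r => positiveSymbols.toUnary r⟩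

theorem positiveIncl_injective (L : Vocab.{u}) : (positiveIncl L).Injective :=
  ⟨fun {_} _ _ h => positiveSymbols.val_injective h,
    fun {_} _ _ h => positiveSymbols.val_injective h⟩

theorem positiveToUnary_injective (L : Vocab.{u}) : (positiveToUnary L).Injective :=
  ⟨fun {_} _ _ h => positiveSymbols.toUnary_injective h,
    fun {_} _ _ h => positiveSymbols.toUnary_injective h⟩

/-- A unary symbol for a former nullary symbol is read as a nullary one, with the value at `z`. -/
def nullaryInterp {F : ℕ → Type u} {X Y : Type*} (z : X)
    (J : ∀ n, unarySymbols F n → (Fin n → X) → Y) : ∀ n, F n → (Fin n → X) → Y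
  | 0, s, _ => J 1 (Sum.inr s) ![z]
  | 1, s, x => J 1 (Sum.inl s) x
  | n + 2, s, x => J (n + 2) s x

theorem uniformContinuous_nullaryInterp {F : ℕ → Type u} {X Y : Type*} [UniformSpace X]
    [UniformSpace Y] (z : X) (J : ∀ n, unarySymbols F n → (Fin n → X) → Y)
    (hJ : ∀ n s, UniformContinuous (J n s)) (n : ℕ) (s : F n) :
    UniformContinuous (nullaryInterp z J n s) := by
  match n, s with
  | 0, s => exact uniformContinuous_const
  | 1, s => exact hJ 1 (Sum.inl s)
  | n + 2, s => exact hJ (n + 2) s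

namespace MetricStr

variable {L : Vocab.{u}}

/-- The base point is arbitrary, so this inverts `unarize` only under `ConstNullary`. -/
noncomputable def nullarize (B : MetricStr (unaryVocab L)) : MetricStr L where
  carrier := B
  dist_le_one := B.dist_le_one
  funMap := nullaryInterp (Classical.arbitrary B) B.funMap
  relMap := nullaryInterp (Classical.arbitrary B) B.relMap
  uc_fun := uniformContinuous_nullaryInterp _ _ B.uc_fun
  uc_rel := uniformContinuous_nullaryInterp _ _ B.uc_rel

/-- The unary symbols for former nullary symbols are interpreted by constant maps. -/
def ConstNullary (B : MetricStr (unaryVocab L)) : Prop :=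
  (∀ (f : L.Functions 0) (x y : B), B.funMap 1 (Sum.inr f) ![x] = B.funMap 1 (Sum.inr f) ![y]) ∧
    ∀ (r : L.Relations 0) (x y : B), B.relMap 1 (Sum.inr r) ![x] = B.relMap 1 (Sum.inr r) ![y]

theorem fin_one_eq {X : Type*} (x : Fin 1 → X) : x = ![x 0] := by
  ext k; fin_cases k; rfl

theorem ConstNullary.iso_unarize {B : MetricStr (unaryVocab L)} (h : B.ConstNullary) :
    B.Iso B.nullarize.unarize := by
  refine ⟨Equiv.refl _, fun _ _ => rfl, fun n f x => ?_, fun n r x => ?_⟩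
  · match n, f with
    | 0, f => exact PEmpty.elim f
    | 1, Sum.inl f => rfl
    | 1, Sum.inr f =>
      rw [fin_one_eq x]
      exact h.1 f _ _
    | n + 2, f => rfl
  · match n, r with
    | 0, r => exact PEmpty.elim r
    | 1, Sum.inl r => rfl
    | 1, Sum.inr r =>
      rw [fin_one_eq x]
      exact h.2 r _ _
    | n + 2, r => rfl

/-- Both structures add only constant maps to this common reduct, so `str_of_reduct` carries
membership in the logic from one to the other. -/
theorem reduct_unarize_iso (M : MetricStr L) :
    (M.reduct (positiveIncl L)).Iso (M.unarize.reduct (positiveToUnary L)) := by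
  refine ⟨Equiv.refl _, fun _ _ => rfl, fun n f x => ?_, fun n r x => ?_⟩
  · match n, f with
    | 0, f => exact PEmpty.elim f
    | 1, f => rfl
    | n + 2, f => rfl
  · match n, r with
    | 0, r => exact PEmpty.elim r
    | 1, r => rfl
    | n + 2, r => rfl

end MetricStr

namespace MetricLogic

variable {ℒ : MetricLogic.{u, v}} {L L' : Vocab.{u}}

theorem str_unarize (hsum : ℒ.ClosedUnderDiscreteSums) {M : MetricStr L} (hM : ℒ.Str M) :
    ℒ.Str M.unarize := by
  refine str_of_reduct hsum _ (positiveToUnary_injective L) _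
    (ℒ.str_iso M.reduct_unarize_iso (ℒ.str_reduct _ M (positiveIncl_injective L) hM))
    (fun n f => ?_) (fun n r => ?_) fun n r x => ?_
  · match n, f with
    | 0, f => exact PEmpty.elim f
    | 1, Sum.inl f => exact Or.inl ⟨f, rfl⟩
    | 1, Sum.inr f => exact Or.inr fun _ _ => rfl
    | n + 2, f => exact Or.inl ⟨f, rfl⟩
  · match n, r with
    | 0, r => exact PEmpty.elim r
    | 1, Sum.inl r => exact Or.inl ⟨r, rfl⟩
    | 1, Sum.inr r => exact Or.inr fun _ _ => rfl
    | n + 2, r => exact Or.inl ⟨r, rfl⟩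
  · match n, r with
    | 0, r => exact PEmpty.elim r
    | 1, Sum.inl r => exact ⟨L, M, hM, _, r, x, rfl⟩
    | 1, Sum.inr r => exact ⟨L, M, hM, _, r, Fin.elim0, rfl⟩
    | n + 2, r => exact ⟨L, M, hM, _, r, x, rfl⟩

theorem str_nullarize (hsum : ℒ.ClosedUnderDiscreteSums) {B : MetricStr (unaryVocab L)}
    (hB : ℒ.Str B) (hc : B.ConstNullary) : ℒ.Str B.nullarize := by
  have h1 := ℒ.str_reduct _ _ (positiveToUnary_injective L) (ℒ.str_iso hc.iso_unarize hB)
  refine str_of_reduct hsum _ (positiveIncl_injective L) _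
    (ℒ.str_iso B.nullarize.reduct_unarize_iso.symm h1)
    (fun n f => ?_) (fun n r => ?_) fun n r x => ?_
  · match n, f with
    | 0, f => exact Or.inr fun _ _ => rfl
    | n + 1, f => exact Or.inl ⟨f, rfl⟩
  · match n, r with
    | 0, f => exact Or.inr fun _ _ => rfl
    | n + 1, f => exact Or.inl ⟨f, rfl⟩
  · match n, r with
    | 0, r => exact ⟨_, B, hB, 1, Sum.inr r, _, rfl⟩
    | 1, r => exact ⟨_, B, hB, 1, Sum.inl r, x, rfl⟩
    | n + 2, r => exact ⟨_, B, hB, n + 2, r, x, rfl⟩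

end MetricLogic

/-! ### Countably complete ultrafilters -/

/-- If no map to `ℕ` tends to infinity along a nonprincipal ultrafilter on `X`, then some
measurable cardinal is at most the cardinality of `X`. -/
theorem exists_measurable_le_of_ultrafilter {X : Type u} (U : Ultrafilter X)
    (hU : ∀ a : X, {a} ∉ U) (hc : ∀ h : X → ℕ, ∃ m, {x | m ≤ h x} ∉ U) :
    ∃ κ : Cardinal.{u}, IsMeasurableCardinal κ ∧ κ ≤ #X := by
  classical
  -- The measurable cardinal is the least size κ of a family of sets of `U` whose intersection is
  -- not in `U`; complements of singletons show κ ≤ |X|.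
  let P : Cardinal.{u} → Prop := fun κ =>
    ∃ S : Set (Set X), #S = κ ∧ (∀ s ∈ S, s ∈ U) ∧ ⋂₀ S ∉ U
  have hP : ∃ κ, P κ ∧ κ ≤ #X := by
    refine ⟨_, ⟨Set.range fun a : X => {a}ᶜ, rfl, ?_, ?_⟩, mk_range_le⟩
    · rintro _ ⟨a, rfl⟩
      exact Ultrafilter.compl_mem_iff_notMem.2 (hU a)
    · have : ⋂₀ Set.range (fun a : X => ({a}ᶜ : Set X)) = ∅ := by
        ext x
        simp
      rw [this]
      exact U.empty_notMem
  obtain ⟨κ₀, hκ₀, hle⟩ := hP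
  obtain ⟨κ, hκ, hmin⟩ := WellFounded.has_min (wellFounded_lt (α := Cardinal.{u})) {κ | P κ}
    ⟨κ₀, hκ₀⟩
  refine ⟨κ, ?_, (not_lt.1 (hmin κ₀ hκ₀)).trans hle⟩
  obtain ⟨S, hS, hSU, hSi⟩ := hκ
  have hcompl : (⋂₀ S)ᶜ ∈ U := Ultrafilter.compl_mem_iff_notMem.2 hSi
  have : Nonempty S := by
    by_contra hne
    rw [not_nonempty_iff, Set.isEmpty_coe_sort] at hne
    exact hSi (by rw [hne, Set.sInter_empty]; exact Filter.univ_mem)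
  -- Each x outside the intersection is sent to a member of the family that misses it. Almost all x
  -- are outside, so a fibre over s in `U` would meet s in the empty set modulo `U`: the image
  -- ultrafilter on `S` is nonprincipal.
  have hg : ∀ x : X, ∃ s : S, x ∈ (⋂₀ S)ᶜ → x ∉ s.1 := by
    intro x
    by_cases hx : x ∈ (⋂₀ S)ᶜ
    · simp only [Set.mem_compl_iff, Set.mem_sInter, not_forall] at hx
      obtain ⟨s, hs, hxs⟩ := hx
      exact ⟨⟨s, hs⟩, fun _ => hxs⟩
    · exact ⟨Classical.arbitrary S, fun h => absurd h hx⟩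
  choose g hg using hg
  have hgU : ∀ s : S, g ⁻¹' {s} ∉ U := by
    intro s hs
    refine Ultrafilter.compl_notMem_iff.2 (hSU s s.2) (Filter.mem_of_superset
      (Filter.inter_mem hs hcompl) ?_)
    rintro x ⟨rfl, hx⟩
    exact hg x hx
  refine ⟨?_, S, U.map g, hS, ⟨fun T hT hTU => ?_⟩, hgU⟩
  -- If `S` were countable, numbering it would turn `g` into a map to ℕ bounded on a set of `U`,
  -- hence constant on one; a fibre of `g` would be in `U`.
  · by_contra! hcount
    rw [← hS, mk_le_aleph0_iff] at hcount
    obtain ⟨f, hf⟩ := exists_injective_nat S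
    obtain ⟨m, hm⟩ := hc fun x => f (g x)
    have hm' := Ultrafilter.compl_mem_iff_notMem.2 hm
    have hsub : {x | m ≤ f (g x)}ᶜ = ⋃ k ∈ Set.Iio m, {x | f (g x) = k} := by
      ext x
      simp
    rw [hsub, Ultrafilter.finite_biUnion_mem_iff (Set.finite_Iio m)] at hm'
    obtain ⟨k, -, hk⟩ := hm'
    obtain ⟨x₀, hx₀⟩ := U.nonempty_of_mem hk
    refine hgU (g x₀) (Filter.mem_of_superset hk fun x hx => ?_)
    exact hf (Eq.trans hx hx₀.symm)
  -- Completeness is minimality of κ, applied to preimages under `g`.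
  · by_contra hnot
    refine hmin #((fun s => g ⁻¹' s) '' T) ⟨_, rfl, ?_, ?_⟩ (mk_image_le.trans_lt hT)
    · rintro _ ⟨s, hs, rfl⟩
      exact hTU s hs
    · intro hmem
      refine hnot ?_
      rw [Set.sInter_image] at hmem
      show g ⁻¹' _ ∈ U
      rw [Set.preimage_sInter]
      exact hmem

/-! ### The vocabulary of the coding structure -/

/-- The witness functions guarantee that slices are nonempty, which relativization needs and which a
supremum quantifier could assert only approximately. -/
inductive AuxFun (X : Type u) : ℕ → Type u
  | const (a : X) : AuxFun X 0
  | name : AuxFun X 1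
  | witness (h : X → ℕ) : AuxFun X 1

inductive AuxRel (X : Type u) : ℕ → Type u
  | main : AuxRel X 1
  | mem (A : Set X) : AuxRel X 1
  | slice (h : X → ℕ) : AuxRel X 2

def codeVocab (L L₀ : Vocab.{u}) (X : Type u) : Vocab.{u} :=
  ⟨fun n => (L.Functions n ⊕ (unaryVocab L₀).Functions n) ⊕ AuxFun X n,
    fun n => (L.Relations n ⊕ (unaryVocab L₀).Relations n) ⊕ AuxRel X n⟩

namespace Code

variable {L L₀ : Vocab.{u}} {X : Type u}

def inclMain (L L₀ : Vocab.{u}) (X : Type u) : L →ᴸ codeVocab L L₀ X :=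
  ⟨fun {_} f => Sum.inl (Sum.inl f), fun {_} r => Sum.inl (Sum.inl r)⟩

def inclPart (L L₀ : Vocab.{u}) (X : Type u) : unaryVocab L₀ →ᴸ codeVocab L L₀ X :=
  ⟨fun {_} f => Sum.inl (Sum.inr f), fun {_} r => Sum.inl (Sum.inr r)⟩

theorem inclMain_injective : (inclMain L L₀ X).Injective :=
  ⟨fun {_} _ _ h => Sum.inl.inj (Sum.inl.inj h), fun {_} _ _ h => Sum.inl.inj (Sum.inl.inj h)⟩

theorem inclPart_injective : (inclPart L L₀ X).Injective :=
  ⟨fun {_} _ _ h => Sum.inr.inj (Sum.inl.inj h), fun {_} _ _ h => Sum.inr.inj (Sum.inl.inj h)⟩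

/-- The truth set of this predicate is the universe of the coded structure. -/
def mainSym : (codeVocab L L₀ X).Relations 1 := Sum.inr AuxRel.main

def memSym (A : Set X) : (codeVocab L L₀ X).Relations 1 := Sum.inr (AuxRel.mem A)

def sliceSym (h : X → ℕ) : (codeVocab L L₀ X).Relations 2 := Sum.inr (AuxRel.slice h)

variable (N : MetricStr (codeVocab L L₀ X))

def Main (x : N) : I := N.relMap 1 mainSym ![x]

/-- The element `x` belongs to the extension of `A ⊆ X`. -/
def Mem (A : Set X) (x : N) : I := N.relMap 1 (memSym A) ![x]

def Slice (h : X → ℕ) (x b : N) : I := N.relMap 2 (sliceSym h) ![x, b]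

/-- The constant for `a : X`. -/
def cst (a : X) : N := N.funMap 0 (Sum.inr (AuxFun.const a) : (codeVocab L L₀ X).Functions 0) ![]

/-- The element of the coded structure named by `x`. -/
def name (x : N) : N := N.funMap 1 (Sum.inr AuxFun.name : (codeVocab L L₀ X).Functions 1) ![x]

/-- An element of the slice at `b`. -/
def witness (h : X → ℕ) (b : N) : N :=
  N.funMap 1 (Sum.inr (AuxFun.witness h) : (codeVocab L L₀ X).Functions 1) ![b]

/-- The extensions of the subsets of `X` define ultrafilters. -/
structure SetAxioms : Prop where
  discrete : ∀ A x, Mem N A x = 0 ∨ Mem N A x = 1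
  mono : ∀ p : {p : Set X × Set X // p.1 ⊆ p.2}, ∀ x, Mem N p.1.1 x = 0 ∨ Mem N p.1.2 x = 1
  inter : ∀ A B x, Mem N A x = 0 ∨ Mem N B x = 0 ∨ Mem N (A ∩ B) x = 1
  compl : ∀ A x, Mem N Set.univ x = 0 ∨ Mem N A x = 1 ∨ Mem N Aᶜ x = 1
  empty : ∀ x, Mem N ∅ x = 0
  singleton : ∀ a x, Mem N {a} x = 0 ∨ x = cst N a
  mem_cst : ∀ a, Mem N {a} (cst N a) = 1

/-- The constants name the elements of a copy of `M`, and names are dense. -/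
structure NameAxioms (M : MetricStr L) (N : MetricStr (codeVocab L L₀ M)) : Prop where
  discrete : ∀ x, Main N x = 0 ∨ Main N x = 1
  main_name : ∀ x, Main N (name N x) = 1
  -- The maximum combines membership of y in the extension of X with closeness of its name to x in
  -- one definable function whose infimum is 0.
  dense : ∀ x, Main N x = 0 ∨ ∀ ε > 0, ∃ y, max (1 - (Mem N Set.univ y : ℝ)) (dist (name N y) x) < ε
  dist_name : ∀ a b : M, dist (name N (cst N a)) (name N (cst N b)) = dist a b
  fun_name : ∀ n (f : L.Functions n) (a : Fin n → M),
    N.funMap n ((inclMain L L₀ M).onFunction f) (fun k => name N (cst N (a k))) =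
      name N (cst N (M.funMap n f a))
  rel_name : ∀ n (r : L.Relations n) (a : Fin n → M),
    (N.relMap n ((inclMain L L₀ M).onRelation r) (fun k => name N (cst N (a k))) : ℝ) =
      M.relMap n r a

/-- The slices are structures in which former nullary symbols are constant maps. -/
structure SliceAxioms : Prop where
  discrete : ∀ h x b, Slice N h x b = 0 ∨ Slice N h x b = 1
  slice_witness : ∀ h b, Slice N h (witness N h b) b = 1
  closed : ∀ h n (f : (unaryVocab L₀).Functions n) (x : Fin n → N) b,
    (∃ k, Slice N h (x k) b = 0) ∨
      Slice N h (N.funMap n ((inclPart L L₀ X).onFunction f) x) b = 1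
  const_fun : ∀ h (f : L₀.Functions 0) x y b, Slice N h x b = 0 ∨ Slice N h y b = 0 ∨
    N.funMap 1 ((inclPart L L₀ X).onFunction (n := 1) (Sum.inr f)) ![x] =
      N.funMap 1 ((inclPart L L₀ X).onFunction (n := 1) (Sum.inr f)) ![y]
  -- An inequality suffices, since x and y may be exchanged.
  const_rel : ∀ h (r : L₀.Relations 0) x y b, Slice N h x b = 0 ∨ Slice N h y b = 0 ∨
    (N.relMap 1 ((inclPart L L₀ X).onRelation (n := 1) (Sum.inr r)) ![x] : ℝ) ≤
      N.relMap 1 ((inclPart L L₀ X).onRelation (n := 1) (Sum.inr r)) ![y]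

end Code

/-! ### Axiomatizability of the coding axioms. -/

namespace MetricLogic

variable {ℒ : MetricLogic.{u, v}} {L L₀ : Vocab.{u}} {X α : Type u}

theorem Expressible.axiomatizable₀ {C : MetricStr L → Prop}
    (h : ℒ.Expressible fun (M : MetricStr L) (_ : PEmpty.{u + 1} → M) => C M) :
    ℒ.Axiomatizable C :=
  h.forall.congr fun _ _ => by simp

theorem Expressible.axiomatizable₁ {C : ∀ M : MetricStr L, M → Prop}
    (h : ℒ.Expressible fun (M : MetricStr L) (a : PUnit.{u + 1} → M) => C M (a PUnit.unit)) :
    ℒ.Axiomatizable fun M => ∀ x, C M x :=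
  h.forall.congr fun _ _ => ⟨fun H x => H fun _ => x, fun H _ => H _⟩

theorem Expressible.axiomatizable₂ {C : ∀ M : MetricStr L, M → M → Prop}
    (h : ℒ.Expressible fun (M : MetricStr L) (a : ULift.{u} (Fin 2) → M) => C M (a ⟨0⟩) (a ⟨1⟩)) :
    ℒ.Axiomatizable fun M => ∀ x y, C M x y :=
  h.forall.congr fun _ _ => ⟨fun H x y => H fun i => ![x, y] i.down, fun H _ => H _ _⟩

theorem Expressible.axiomatizable₃ {C : ∀ M : MetricStr L, M → M → M → Prop}
    (h : ℒ.Expressible fun (M : MetricStr L) (a : ULift.{u} (Fin 3) → M) =>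
      C M (a ⟨0⟩) (a ⟨1⟩) (a ⟨2⟩)) :
    ℒ.Axiomatizable fun M => ∀ x y z, C M x y z :=
  h.forall.congr fun _ _ => ⟨fun H x y z => H fun i => ![x, y, z] i.down, fun H _ => H _ _ _⟩

open Code

section

variable {τ τ' : ∀ N : MetricStr (codeVocab L L₀ X), (α → N) → N}

theorem TermDefinable.name (hτ : TermDefinable τ) :
    TermDefinable fun N a => name N (τ N a) := TermDefinable.app₁ _ hτ

theorem TermDefinable.witness (h : X → ℕ) (hτ : TermDefinable τ) :
    TermDefinable fun N a => witness N h (τ N a) := TermDefinable.app₁ _ hτ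

theorem TermDefinable.cst (x : X) :
    TermDefinable fun (N : MetricStr (codeVocab L L₀ X)) (_ : α → N) => cst N x :=
  TermDefinable.app₀ _

theorem Expressible.main_eq_one (hτ : TermDefinable τ) :
    ℒ.Expressible fun N a => Main N (τ N a) = 1 := Expressible.rel₁_eq_one _ hτ

theorem Expressible.main_eq_zero (hτ : TermDefinable τ) :
    ℒ.Expressible fun N a => Main N (τ N a) = 0 := Expressible.rel₁_eq_zero _ hτ

theorem Expressible.mem_eq_one (A : Set X) (hτ : TermDefinable τ) :
    ℒ.Expressible fun N a => Mem N A (τ N a) = 1 := Expressible.rel₁_eq_one _ hτ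

theorem Expressible.mem_eq_zero (A : Set X) (hτ : TermDefinable τ) :
    ℒ.Expressible fun N a => Mem N A (τ N a) = 0 := Expressible.rel₁_eq_zero _ hτ

theorem Expressible.slice_eq_one (h : X → ℕ) (hτ : TermDefinable τ) (hτ' : TermDefinable τ') :
    ℒ.Expressible fun N a => Slice N h (τ N a) (τ' N a) = 1 := Expressible.rel₂_eq_one _ hτ hτ'

theorem Expressible.slice_eq_zero (h : X → ℕ) (hτ : TermDefinable τ) (hτ' : TermDefinable τ') :
    ℒ.Expressible fun N a => Slice N h (τ N a) (τ' N a) = 0 := Expressible.rel₂_eq_zero _ hτ hτ'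

end

open TermDefinable in
-- For fixed subsets of X each law is a disjunction of closed conditions in at most one variable;
-- the subsets themselves only index the theory.
theorem axiomatizable_setAxioms :
    ℒ.Axiomatizable (SetAxioms : MetricStr (codeVocab L L₀ X) → Prop) := by
  have h1 : ℒ.Axiomatizable fun N : MetricStr (codeVocab L L₀ X) => ∀ A, ∀ x,
      Mem N A x = 0 ∨ Mem N A x = 1 := Axiomatizable.forall fun A =>
    ((Expressible.mem_eq_zero A (var _)).or (Expressible.mem_eq_one A (var _))).axiomatizable₁
  have h2 : ℒ.Axiomatizable fun N : MetricStr (codeVocab L L₀ X) =>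
      ∀ p : {p : Set X × Set X // p.1 ⊆ p.2}, ∀ x, Mem N p.1.1 x = 0 ∨ Mem N p.1.2 x = 1 :=
    Axiomatizable.forall fun p =>
    ((Expressible.mem_eq_zero _ (var _)).or (Expressible.mem_eq_one _ (var _))).axiomatizable₁
  have h3 : ℒ.Axiomatizable fun N : MetricStr (codeVocab L L₀ X) => ∀ A, ∀ B, ∀ x,
      Mem N A x = 0 ∨ Mem N B x = 0 ∨ Mem N (A ∩ B) x = 1 :=
    Axiomatizable.forall fun A => Axiomatizable.forall fun B =>
    ((Expressible.mem_eq_zero _ (var _)).or ((Expressible.mem_eq_zero _ (var _)).or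
      (Expressible.mem_eq_one _ (var _)))).axiomatizable₁
  have h4 : ℒ.Axiomatizable fun N : MetricStr (codeVocab L L₀ X) => ∀ A, ∀ x,
      Mem N Set.univ x = 0 ∨ Mem N A x = 1 ∨ Mem N Aᶜ x = 1 :=
    Axiomatizable.forall fun A =>
    ((Expressible.mem_eq_zero _ (var _)).or ((Expressible.mem_eq_one _ (var _)).or
      (Expressible.mem_eq_one _ (var _)))).axiomatizable₁
  have h5 : ℒ.Axiomatizable fun N : MetricStr (codeVocab L L₀ X) => ∀ x, Mem N ∅ x = 0 :=
    (Expressible.mem_eq_zero _ (var _)).axiomatizable₁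
  have h6 : ℒ.Axiomatizable fun N : MetricStr (codeVocab L L₀ X) => ∀ a, ∀ x,
      Mem N {a} x = 0 ∨ x = Code.cst N a :=
    Axiomatizable.forall fun a =>
    ((Expressible.mem_eq_zero _ (var _)).or
      (Expressible.term_eq (var _) (TermDefinable.cst a))).axiomatizable₁
  have h7 : ℒ.Axiomatizable fun N : MetricStr (codeVocab L L₀ X) => ∀ a,
      Mem N {a} (Code.cst N a) = 1 :=
    Axiomatizable.forall fun a => (Expressible.mem_eq_one _ (TermDefinable.cst a)).axiomatizable₀
  exact (h1.and (h2.and (h3.and (h4.and (h5.and (h6.and h7)))))).congr fun N _ =>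
    ⟨fun ⟨a1, a2, a3, a4, a5, a6, a7⟩ => ⟨a1, a2, a3, a4, a5, a6, a7⟩,
      fun ⟨a1, a2, a3, a4, a5, a6, a7⟩ => ⟨a1, a2, a3, a4, a5, a6, a7⟩⟩

open TermDefinable in
theorem axiomatizable_nameAxioms (M : MetricStr L) :
    ℒ.Axiomatizable (NameAxioms M : MetricStr (codeVocab L L₀ M) → Prop) := by
  have h1 : ℒ.Axiomatizable fun N : MetricStr (codeVocab L L₀ M) => ∀ x,
      Main N x = 0 ∨ Main N x = 1 :=
    ((Expressible.main_eq_zero (var _)).or (Expressible.main_eq_one (var _))).axiomatizable₁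
  have h2 : ℒ.Axiomatizable fun N : MetricStr (codeVocab L L₀ M) => ∀ x,
      Main N (Code.name N x) = 1 :=
    (Expressible.main_eq_one (TermDefinable.name (var _))).axiomatizable₁
  have h3 : ℒ.Axiomatizable fun N : MetricStr (codeVocab L L₀ M) => ∀ x, Main N x = 0 ∨
      ∀ ε > 0, ∃ y, max (1 - (Mem N Set.univ y : ℝ)) (dist (Code.name N y) x) < ε := by
    have : ℒ.Definable fun (N : MetricStr (codeVocab L L₀ M)) (a : Option PUnit.{u + 1} → N) =>
        max (1 - (Mem N Set.univ (a none) : ℝ)) (dist (Code.name N (a none)) (a (some PUnit.unit))) :=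
      (Definable.rel₁ _ (var _)).not.sup (Definable.dist (TermDefinable.name (var _)) (var _))
    exact ((Expressible.main_eq_zero (var _)).or this.exists_approx).axiomatizable₁
  have h4 : ℒ.Axiomatizable fun N : MetricStr (codeVocab L L₀ M) => ∀ a : M, ∀ b : M,
      dist (Code.name N (Code.cst N a)) (Code.name N (Code.cst N b)) = dist a b :=
    Axiomatizable.forall fun a => Axiomatizable.forall fun b =>
    ((Definable.dist (α := PEmpty) (TermDefinable.name (TermDefinable.cst a))
      (TermDefinable.name (TermDefinable.cst b))).axiomatizable_eq (dist a b)).congr fun _ _ => by simp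
  have h5 : ℒ.Axiomatizable fun N : MetricStr (codeVocab L L₀ M) => ∀ n, ∀ f : L.Functions n,
      ∀ a : Fin n → M,
      N.funMap n ((inclMain L L₀ M).onFunction f) (fun k => Code.name N (Code.cst N (a k))) =
        Code.name N (Code.cst N (M.funMap n f a)) :=
    Axiomatizable.forall fun n => Axiomatizable.forall fun f => Axiomatizable.forall fun a =>
    (Expressible.term_eq (TermDefinable.app _ fun k => TermDefinable.name (TermDefinable.cst _))
      (TermDefinable.name (TermDefinable.cst _))).axiomatizable₀
  have h6 : ℒ.Axiomatizable fun N : MetricStr (codeVocab L L₀ M) => ∀ n, ∀ r : L.Relations n,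
      ∀ a : Fin n → M,
      (N.relMap n ((inclMain L L₀ M).onRelation r) (fun k => Code.name N (Code.cst N (a k))) : ℝ) =
        M.relMap n r a :=
    Axiomatizable.forall fun n => Axiomatizable.forall fun r => Axiomatizable.forall fun a =>
    ((Definable.rel (α := PEmpty) ((inclMain L L₀ M).onRelation r) fun k =>
      TermDefinable.name (TermDefinable.cst (a k))).axiomatizable_eq
        (M.relMap n r a)).congr fun _ _ => by simp
  exact (h1.and (h2.and (h3.and (h4.and (h5.and h6))))).congr fun N _ =>
    ⟨fun ⟨a1, a2, a3, a4, a5, a6⟩ => ⟨a1, a2, a3, a4, a5, a6⟩,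
      fun ⟨a1, a2, a3, a4, a5, a6⟩ => ⟨a1, a2, a3, a4, a5, a6⟩⟩

open TermDefinable in
theorem axiomatizable_sliceAxioms :
    ℒ.Axiomatizable (SliceAxioms : MetricStr (codeVocab L L₀ X) → Prop) := by
  have h1 : ℒ.Axiomatizable fun N : MetricStr (codeVocab L L₀ X) => ∀ h, ∀ x b,
      Slice N h x b = 0 ∨ Slice N h x b = 1 :=
    Axiomatizable.forall fun h => ((Expressible.slice_eq_zero h (var _) (var _)).or
      (Expressible.slice_eq_one h (var _) (var _))).axiomatizable₂
  have h2 : ℒ.Axiomatizable fun N : MetricStr (codeVocab L L₀ X) => ∀ h, ∀ b,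
      Slice N h (Code.witness N h b) b = 1 :=
    Axiomatizable.forall fun h =>
      (Expressible.slice_eq_one h (TermDefinable.witness h (var _)) (var _)).axiomatizable₁
  have h3 : ℒ.Axiomatizable fun N : MetricStr (codeVocab L L₀ X) => ∀ h, ∀ n,
      ∀ f : (unaryVocab L₀).Functions n, ∀ (x : Fin n → N) (b : N), (∃ k, Slice N h (x k) b = 0) ∨
      Slice N h (N.funMap n ((inclPart L L₀ X).onFunction f) x) b = 1 := by
    refine Axiomatizable.forall fun h => Axiomatizable.forall fun n => Axiomatizable.forall fun f => ?_
    have hk : ∀ k : Fin n, ℒ.Expressible fun (N : MetricStr (codeVocab L L₀ X))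
        (a : ULift.{u} (Option (Fin n)) → N) => Slice N h (a ⟨some k⟩) (a ⟨none⟩) = 0 := fun k =>
      Expressible.slice_eq_zero h (var _) (var _)
    have hf : ℒ.Expressible fun (N : MetricStr (codeVocab L L₀ X))
        (a : ULift.{u} (Option (Fin n)) → N) =>
        Slice N h (N.funMap n ((inclPart L L₀ X).onFunction f) fun k => a ⟨some k⟩) (a ⟨none⟩) = 1 :=
      Expressible.slice_eq_one h (TermDefinable.app _ fun k => var _) (var _)
    exact ((Expressible.exists_fin hk).or hf).forall.congr fun N _ =>
      ⟨fun H x b => H fun i => i.down.elim b x, fun H a => H _ _⟩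
  have h4 : ℒ.Axiomatizable fun N : MetricStr (codeVocab L L₀ X) => ∀ h, ∀ f : L₀.Functions 0,
      ∀ x y b, Slice N h x b = 0 ∨ Slice N h y b = 0 ∨
      N.funMap 1 ((inclPart L L₀ X).onFunction (n := 1) (Sum.inr f)) ![x] =
        N.funMap 1 ((inclPart L L₀ X).onFunction (n := 1) (Sum.inr f)) ![y] :=
    Axiomatizable.forall fun h => Axiomatizable.forall fun f =>
      ((Expressible.slice_eq_zero h (var _) (var _)).or
        ((Expressible.slice_eq_zero h (var _) (var _)).or
          (Expressible.term_eq (TermDefinable.app₁ _ (var _))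
            (TermDefinable.app₁ _ (var _))))).axiomatizable₃
  have h5 : ℒ.Axiomatizable fun N : MetricStr (codeVocab L L₀ X) => ∀ h, ∀ r : L₀.Relations 0,
      ∀ x y b, Slice N h x b = 0 ∨ Slice N h y b = 0 ∨
      (N.relMap 1 ((inclPart L L₀ X).onRelation (n := 1) (Sum.inr r)) ![x] : ℝ) ≤
        N.relMap 1 ((inclPart L L₀ X).onRelation (n := 1) (Sum.inr r)) ![y] :=
    Axiomatizable.forall fun h => Axiomatizable.forall fun f =>
      ((Expressible.slice_eq_zero h (var _) (var _)).or
        ((Expressible.slice_eq_zero h (var _) (var _)).or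
          ((Definable.rel₁ _ (var _)).le (Definable.rel₁ _ (var _))))).axiomatizable₃
  exact (h1.and (h2.and (h3.and (h4.and h5)))).congr fun N _ =>
    ⟨fun ⟨a1, a2, a3, a4, a5⟩ => ⟨a1, a2, a3, a4, a5⟩,
      fun ⟨a1, a2, a3, a4, a5⟩ => ⟨a1, a2, a3, a4, a5⟩⟩

theorem axiomatizable_relativized (h : X → ℕ) (m : ℕ)
    (ψ : ℒ.Sent ((codeVocab L L₀ X)[[PUnit.{u + 1}]])) :
    ℒ.Axiomatizable fun N : MetricStr (codeVocab L L₀ X) => ∀ b : N,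
      Mem N {a | m ≤ h a} b = 0 ∨ ℒ.val (N.withConst fun _ : PUnit.{u + 1} => b) ψ = 1 := by
  have hψ : ℒ.Expressible fun (N : MetricStr (codeVocab L L₀ X)) (a : PUnit.{u + 1} → N) =>
      ℒ.val (N.withConst fun _ : PUnit.{u + 1} => a PUnit.unit) ψ = 1 := ⟨ψ, fun _ _ _ => Iff.rfl⟩
  exact ((Expressible.mem_eq_zero _ (TermDefinable.var _)).or hψ).axiomatizable₁

end MetricLogic

/-! ### Consequences of the axioms: slices, ultrafilters and the copy of M. -/

namespace Code

variable {L L₀ : Vocab.{u}} {X : Type u} {N : MetricStr (codeVocab L L₀ X)}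

theorem SliceAxioms.isDiscrete (hN : SliceAxioms N) (h : X → ℕ) : N.IsDiscrete (sliceSym h) := by
  intro x
  have : x = ![x 0, x 1] := by ext k; fin_cases k <;> rfl
  rw [this]
  exact hN.discrete h _ _

theorem SliceAxioms.slice_nonempty (hN : SliceAxioms N) (h : X → ℕ) (b : N) :
    (N.slice (sliceSym h) b).Nonempty := ⟨_, hN.slice_witness h b⟩

theorem SliceAxioms.closedSet (hN : SliceAxioms N) (h : X → ℕ) (b : N) :
    (N.reduct (inclPart L L₀ X)).ClosedSet (N.slice (sliceSym h) b) := by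
  intro n f x hx
  refine (hN.closed h n f x b).resolve_left ?_
  rintro ⟨k, hk⟩
  exact zero_ne_one (hk.symm.trans (hx k))

theorem SliceAxioms.constNullary (hN : SliceAxioms N) (h : X → ℕ) (b : N) :
    ((N.reduct (inclPart L L₀ X)).restrict (N.slice (sliceSym h) b) (hN.slice_nonempty h b)
      (hN.closedSet h b)).ConstNullary := by
  have hne : ∀ x ∈ N.slice (sliceSym h) b, ¬ Slice N h x b = 0 := fun x hx h0 =>
    zero_ne_one (h0.symm.trans hx)
  have key : ∀ x (hx : x ∈ N.slice (sliceSym h) b),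
      (fun k : Fin 1 => ((![⟨x, hx⟩] : Fin 1 → N.slice (sliceSym h) b) k).1) = ![x] := fun x hx => by
    ext k; fin_cases k; rfl
  constructor
  · rintro f ⟨x, hx⟩ ⟨y, hy⟩
    refine Subtype.ext ?_
    have := ((hN.const_fun h f x y b).resolve_left (hne x hx)).resolve_left (hne y hy)
    rw [← key x hx, ← key y hy] at this
    exact this
  · rintro r ⟨x, hx⟩ ⟨y, hy⟩
    have h1 := ((hN.const_rel h r x y b).resolve_left (hne x hx)).resolve_left (hne y hy)
    have h2 := ((hN.const_rel h r y x b).resolve_left (hne y hy)).resolve_left (hne x hx)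
    have := Subtype.ext (le_antisymm h1 h2)
    rw [← key x hx, ← key y hy] at this
    exact this

/-- The ultrafilter of the subsets of `X` whose extensions contain `x`. -/
noncomputable def SetAxioms.ultrafilter (hN : SetAxioms N) {x : N} (hx : Mem N Set.univ x = 1) :
    Ultrafilter X :=
  Ultrafilter.ofComplNotMemIff
    { sets := {A | Mem N A x = 1}
      univ_sets := hx
      sets_of_superset := fun {A B} hA hAB =>
        (hN.mono ⟨(A, B), hAB⟩ x).resolve_left fun h0 => zero_ne_one (h0.symm.trans hA)
      inter_sets := fun {A B} hA hB =>
        ((hN.inter A B x).resolve_left fun h0 => zero_ne_one (h0.symm.trans hA)).resolve_left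
          fun h0 => zero_ne_one (h0.symm.trans hB) } <| by
    intro A
    show ¬ Mem N Aᶜ x = 1 ↔ Mem N A x = 1
    constructor
    · intro h
      exact ((hN.compl A x).resolve_left fun h0 => zero_ne_one (h0.symm.trans hx)).resolve_right h
    · intro hA hB
      have := ((hN.inter A Aᶜ x).resolve_left fun h0 => zero_ne_one (h0.symm.trans hA)).resolve_left
          fun h0 => zero_ne_one (h0.symm.trans hB)
      rw [Set.inter_compl_self, hN.empty x] at this
      exact zero_ne_one this

/-- If every element of the extension of `X` is the value of a constant, then the main part is a
copy of the complete structure `M`. -/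
theorem NameAxioms.iso {M : MetricStr L} [CompleteSpace M] {N : MetricStr (codeVocab L L₀ M)}
    (hN : NameAxioms M N) (hS : SetAxioms N)
    (hcst : ∀ x, Mem N Set.univ x = 1 → ∃ a, x = cst N a)
    (hne : (N.truthSet mainSym).Nonempty)
    (hcl : (N.reduct (inclMain L L₀ M)).ClosedSet (N.truthSet mainSym)) :
    M.Iso ((N.reduct (inclMain L L₀ M)).restrict (N.truthSet mainSym) hne hcl) := by
  let F : M → N := fun a => name N (cst N a)
  have hF : Isometry F := Isometry.of_dist_eq hN.dist_name
  have hrange : Set.range F = N.truthSet mainSym := by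
    refine Set.Subset.antisymm ?_ fun x hx => ?_
    · rintro _ ⟨a, rfl⟩
      exact hN.main_name _
    -- An isometric image of the complete space `M` is closed, so it is enough to approximate x by
    -- names of constants.
    · have hclosed : IsClosed (Set.range F) := hF.isClosedEmbedding.isClosed_range
      rw [← hclosed.closure_eq, Metric.mem_closure_iff]
      intro ε hε
      have h1 := (hN.dense x).resolve_left fun h0 => zero_ne_one (h0.symm.trans hx)
      -- An error below 1 forces the discrete predicate to be 1 at y, so y really lies in the
      -- extension of X.
      obtain ⟨y, hy⟩ := h1 (min ε 1) (lt_min hε one_pos)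
      have hy1 : 1 - (Mem N Set.univ y : ℝ) < 1 :=
        (le_max_left _ _).trans_lt (hy.trans_le (min_le_right _ _))
      have hy2 : Mem N Set.univ y = 1 := by
        refine (hS.discrete Set.univ y).resolve_left fun h0 => ?_
        rw [h0] at hy1
        simp at hy1
      obtain ⟨a, rfl⟩ := hcst y hy2
      refine ⟨F a, ⟨a, rfl⟩, ?_⟩
      rw [dist_comm]
      exact (le_max_right _ _).trans_lt (hy.trans_le (min_le_left _ _))
  refine ⟨Equiv.ofBijective (fun a => (⟨F a, hN.main_name _⟩ : N.truthSet mainSym)) ⟨?_, ?_⟩,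
    hN.dist_name, ?_, ?_⟩
  · exact fun a b h => hF.injective (congrArg Subtype.val h)
  · rintro ⟨x, hx⟩
    rw [← hrange] at hx
    obtain ⟨a, rfl⟩ := hx
    exact ⟨a, rfl⟩
  · exact fun n f a => Subtype.ext (hN.fun_name n f a)
  · exact fun n r a => Subtype.ext (hN.rel_name n r a)

end Code

/-! ### Every element of the extension of X is a constant. -/

namespace MetricLogic

open Code

variable {ℒ : MetricLogic.{u, v}} {L L₀ : Vocab.{u}}

/-- `ψ` is the relativization of `φ` to the slices of `R`. -/
def IsRelativization {L' : Vocab.{u}} (ι : L →ᴸ L') (R : L'.Relations 2) (φ : ℒ.Sent L)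
    (ψ : ℒ.Sent (L'[[PUnit.{u + 1}]])) : Prop :=
  ∀ M : MetricStr L', ℒ.Str M → M.IsDiscrete R →
    ∀ (hne : ∀ b : M, (M.slice R b).Nonempty)
      (hcl : ∀ b : M, (M.reduct ι).ClosedSet (M.slice R b)) (b : M),
      ℒ.Str ((M.reduct ι).restrict (M.slice R b) (hne b) (hcl b)) ∧
        ℒ.val (M.withConst fun _ : PUnit.{u + 1} => b) ψ =
          ℒ.val ((M.reduct ι).restrict (M.slice R b) (hne b) (hcl b)) φ

theorem exists_relativization (hreg : ℒ.IsRegular) {X : Type u} (h : X → ℕ)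
    (φ : ℒ.Sent (unaryVocab L₀)) : ∃ ψ, IsRelativization (inclPart L L₀ X) (sliceSym h) φ ψ :=
  hreg _ _ _ inclPart_injective _ (by rintro ⟨r, hr⟩; cases hr) φ

/-- If x were no constant, its ultrafilter would be nonprincipal. For any h some {a | m ≤ h a} is
outside it, or else the slice of h at x would satisfy all T_m; so a measurable cardinal at most |X|
would exist. -/
theorem exists_eq_cst_of_axioms (hsum : ℒ.ClosedUnderDiscreteSums) {X : Type u}
    (hcard : ∀ κ : Cardinal.{u}, IsMeasurableCardinal κ → #X < κ)
    {T : ℕ → Set (ℒ.Sent L₀)} (hT : ∀ B, ℒ.Str B → ¬ ∀ n, ∀ φ ∈ T n, ℒ.val B φ = 1)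
    {nul : ℒ.Sent L₀ → ℒ.Sent (unaryVocab L₀)}
    (hnul : ∀ φ M, ℒ.Str M → ℒ.Str M.unarize → ℒ.val M.unarize (nul φ) = ℒ.val M φ)
    {rel : (X → ℕ) → ℒ.Sent (unaryVocab L₀) → ℒ.Sent ((codeVocab L L₀ X)[[PUnit.{u + 1}]])}
    (hrel : ∀ h φ, IsRelativization (inclPart L L₀ X) (sliceSym h) φ (rel h φ))
    {N : MetricStr (codeVocab L L₀ X)} (hN : ℒ.Str N) (hset : SetAxioms N) (hsl : SliceAxioms N)
    (hmod : ∀ h m, ∀ φ ∈ T m, ∀ b : N, Mem N {a | m ≤ h a} b = 0 ∨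
      ℒ.val (N.withConst fun _ : PUnit.{u + 1} => b) (rel h (nul φ)) = 1)
    (x : N) (hx : Mem N Set.univ x = 1) : ∃ a, x = cst N a := by
  by_contra! hcst
  obtain ⟨κ, hκ, hle⟩ := exists_measurable_le_of_ultrafilter (hset.ultrafilter hx)
    (fun a ha => (hset.singleton a x).elim (fun h0 => zero_ne_one (h0.symm.trans ha)) (hcst a)) <| by
    intro h
    by_contra! hall
    have hr := fun φ => hrel h φ N hN (hsl.isDiscrete h) (hsl.slice_nonempty h) (hsl.closedSet h) x
    -- Any sentence will do: its relativization yields that the slice belongs to the logic.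
    obtain ⟨φ₀, -⟩ : ∃ φ : ℒ.Sent (unaryVocab L₀), True :=
      (ℒ.exists_rat _ 0 le_rfl zero_le_one).imp fun _ _ => trivial
    have hB := (hr φ₀).1
    have hc := hsl.constNullary h x
    have hB' := str_nullarize hsum hB hc
    refine hT _ hB' fun n φ hφ => ?_
    -- The value of φ in the slice with nullary symbols restored is that of `nul φ` in the slice,
    -- which is that of the relativized formula at x.
    rw [← hnul φ _ hB' (str_unarize hsum hB'),
      ← ℒ.val_iso _ hB (str_unarize hsum hB') hc.iso_unarize, ← (hr (nul φ)).2]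
    exact (hmod h n φ hφ x).resolve_left fun h0 => zero_ne_one (h0.symm.trans (hall n))
  exact absurd (hcard κ hκ) (not_lt.2 hle)

end MetricLogic

/-! ### The coding structure and its axioms. -/

namespace Code

/-- The parts of the coding structure: the coded structure, a point for each of its elements, and a
sequence of structures. -/
inductive PartIdx (X : Type u) : Type u
  | main
  | pt (a : X)
  | seq (n : ℕ)

variable {L L₀ : Vocab.{u}}

abbrev partVocab (L L₀ : Vocab.{u}) (X : Type u) : PartIdx X → Vocab.{u}
  | .main => L
  | .pt _ => emptyVocab
  | .seq _ => unaryVocab L₀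

noncomputable abbrev partStr (M : MetricStr L) (B : ℕ → MetricStr L₀) :
    ∀ i : PartIdx M, MetricStr (partVocab L L₀ M i)
  | .main => M
  | .pt _ => pointStr
  | .seq n => (B n).unarize

def partIncl (L L₀ : Vocab.{u}) (X : Type u) :
    ∀ i : PartIdx X, partVocab L L₀ X i →ᴸ codeVocab L L₀ X
  | .main => inclMain L L₀ X
  | .pt _ => ⟨fun {_} f => PEmpty.elim f, fun {_} r => PEmpty.elim r⟩
  | .seq _ => inclPart L L₀ X

theorem partIncl_injective (X : Type u) (i : PartIdx X) : (partIncl L L₀ X i).Injective :=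
  match i with
  | .main => inclMain_injective
  | .pt _ => ⟨fun {_} f => PEmpty.elim f, fun {_} r => PEmpty.elim r⟩
  | .seq _ => inclPart_injective

/-- The number of the structure of the sequence that is the slice at a given part. -/
def level {X : Type u} (h : X → ℕ) : PartIdx X → ℕ
  | .pt a => h a
  -- Regularity needs a nonempty closed slice at every element, so B_0 is used away from the points.
  | _ => 0

/-- The default values keep names in the main part and witnesses in the proper slice for all
arguments. -/
noncomputable def auxFunMap (M : MetricStr L) (B : ℕ → MetricStr L₀) :
    ∀ n, AuxFun M n → (Fin n → PartIdx M) → Σ i, partStr M B i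
  | _, .const a, _ => ⟨.pt a, PUnit.unit⟩
  | _, .name, p => match p 0 with
    | .pt a => ⟨.main, a⟩
    | _ => ⟨.main, Classical.arbitrary M⟩
  | _, .witness h, p => ⟨.seq (level h (p 0)), Classical.arbitrary (B (level h (p 0))).unarize⟩

open Classical in
noncomputable def auxRelMap (X : Type u) : ∀ n, AuxRel X n → (Fin n → PartIdx X) → I
  | _, .main, p => if p 0 = .main then 1 else 0
  | _, .mem A, p => if ∃ a ∈ A, p 0 = .pt a then 1 else 0
  | _, .slice h, p => if p 0 = .seq (level h (p 1)) then 1 else 0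

/-- The symbols have common moduli of uniform continuity in all structures of the sequence. -/
def Equicontinuous (B : ℕ → MetricStr L₀) : Prop :=
  (∀ n (f : L₀.Functions n), ∀ ε > (0 : ℝ), ∃ δ > 0, ∀ m (x y : Fin n → B m), dist x y < δ →
    dist ((B m).funMap n f x) ((B m).funMap n f y) ≤ ε) ∧
  ∀ n (f : L₀.Relations n), ∀ ε > (0 : ℝ), ∃ δ > 0, ∀ m (x y : Fin n → B m), dist x y < δ →
    dist ((B m).relMap n f x) ((B m).relMap n f y) ≤ ε

theorem Equicontinuous.unarize {B : ℕ → MetricStr L₀} (hB : Equicontinuous B) :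
    Equicontinuous fun n => (B n).unarize := by
  constructor
  · intro n f ε hε
    match n, f with
    | 0, f => exact PEmpty.elim f
    | 1, Sum.inl f => exact hB.1 1 f ε hε
    | 1, Sum.inr f => exact ⟨1, one_pos, fun m x y _ => (dist_self _).trans_le hε.le⟩
    | n + 2, f => exact hB.1 (n + 2) f ε hε
  · intro n f ε hε
    match n, f with
    | 0, f => exact PEmpty.elim f
    | 1, Sum.inl f => exact hB.2 1 f ε hε
    | 1, Sum.inr f => exact ⟨1, one_pos, fun m x y _ => (dist_self _).trans_le hε.le⟩
    | n + 2, f => exact hB.2 (n + 2) f ε hε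

/-- The symbols of `unaryVocab L₀` act in all the B_n at once, so none may be nullary and the
sequence must be equicontinuous. Values of symbols outside their own parts are irrelevant to `M` and
to the slices. -/
noncomputable def sumData (M : MetricStr L) (B : ℕ → MetricStr L₀) (hB : Equicontinuous B) :
    SumData (codeVocab L L₀ M) where
  Idx := PartIdx M
  nonempty := ⟨.main⟩
  S := partVocab L L₀ M
  M := partStr M B
  incl := partIncl L L₀ M
  incl_injective := partIncl_injective M
  fun_zero
    | .main, .main, _, _, _ => rfl
    | .main, .seq _, _, g, _ => PEmpty.elim g
    | .pt _, _, f, _, _ => PEmpty.elim f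
    | _, .pt _, _, g, _ => PEmpty.elim g
    | .seq _, _, f, _, _ => PEmpty.elim f
  rel_zero
    | .main, .main, _, _, _ => rfl
    | .main, .seq _, _, g, _ => PEmpty.elim g
    | .pt _, _, f, _, _ => PEmpty.elim f
    | _, .pt _, _, g, _ => PEmpty.elim g
    | .seq _, _, f, _, _ => PEmpty.elim f
  defFun n s p := Sum.elim (fun _ => ⟨.main, Classical.arbitrary M⟩)
    (fun f => auxFunMap M B n f p) s
  defRel n s p := Sum.elim (fun _ => 0) (fun r => auxRelMap M n r p) s
  uniform_fun n s ε hε := by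
    rcases s with (f | f) | f
    · obtain ⟨δ, hδ, h⟩ := Metric.uniformContinuous_iff.1 (M.uc_fun n f) ε hε
      refine ⟨δ, hδ, ?_⟩
      rintro (_ | a | m) f' hf'
      · obtain rfl : f' = f := Sum.inl.inj (Sum.inl.inj hf')
        exact fun x y hxy => (h hxy).le
      · exact PEmpty.elim f'
      · cases hf'
    · obtain ⟨δ, hδ, h⟩ := hB.unarize.1 n f ε hε
      refine ⟨δ, hδ, ?_⟩
      rintro (_ | a | m) f' hf'
      · cases hf'
      · exact PEmpty.elim f'
      · obtain rfl : f' = f := Sum.inr.inj (Sum.inl.inj hf')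
        exact h m
    · refine ⟨1, one_pos, ?_⟩
      rintro (_ | a | m) f' hf'
      · cases hf'
      · exact PEmpty.elim f'
      · cases hf'
  uniform_rel n s ε hε := by
    rcases s with (f | f) | f
    · obtain ⟨δ, hδ, h⟩ := Metric.uniformContinuous_iff.1 (M.uc_rel n f) ε hε
      refine ⟨δ, hδ, ?_⟩
      rintro (_ | a | m) f' hf'
      · obtain rfl : f' = f := Sum.inl.inj (Sum.inl.inj hf')
        exact fun x y hxy => (h hxy).le
      · exact PEmpty.elim f'
      · cases hf'
    · obtain ⟨δ, hδ, h⟩ := hB.unarize.2 n f ε hε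
      refine ⟨δ, hδ, ?_⟩
      rintro (_ | a | m) f' hf'
      · cases hf'
      · exact PEmpty.elim f'
      · obtain rfl : f' = f := Sum.inr.inj (Sum.inl.inj hf')
        exact h m
    · refine ⟨1, one_pos, ?_⟩
      rintro (_ | a | m) f' hf'
      · cases hf'
      · exact PEmpty.elim f'
      · cases hf'

theorem auxFun_not_mem_range {X : Type u} {n : ℕ} (f : AuxFun X n) (i : PartIdx X) :
    (Sum.inr f : (codeVocab L L₀ X).Functions n) ∉
      Set.range ((partIncl L L₀ X i).onFunction (n := n)) := by
  rintro ⟨g, hg⟩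
  rcases i with _ | a | m
  · cases hg
  · exact PEmpty.elim g
  · cases hg

theorem auxRel_not_mem_range {X : Type u} {n : ℕ} (f : AuxRel X n) (i : PartIdx X) :
    (Sum.inr f : (codeVocab L L₀ X).Relations n) ∉
      Set.range ((partIncl L L₀ X i).onRelation (n := n)) := by
  rintro ⟨g, hg⟩
  rcases i with _ | a | m
  · cases hg
  · exact PEmpty.elim g
  · cases hg

section

open Classical

variable (M : MetricStr L) (B : ℕ → MetricStr L₀) (hB : Equicontinuous B)

/-- The coding structure. -/
noncomputable def codeStr : MetricStr (codeVocab L L₀ M) := (sumData M B hB).sum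

noncomputable def partOf (p : codeStr M B hB) : PartIdx M := SumData.part (D := sumData M B hB) p

noncomputable def embMain (x : M) : codeStr M B hB := SumData.emb (D := sumData M B hB) .main x

noncomputable def point (a : M) : codeStr M B hB :=
  SumData.emb (D := sumData M B hB) (.pt a) PUnit.unit

noncomputable def embSeq (n : ℕ) (x : (B n).unarize) : codeStr M B hB :=
  SumData.emb (D := sumData M B hB) (.seq n) x

variable {M B hB}

theorem exists_eq_embMain {p : codeStr M B hB} (hp : partOf M B hB p = .main) :
    ∃ x, p = embMain M B hB x := SumData.exists_eq_emb hp

theorem eq_point {p : codeStr M B hB} {a : M} (hp : partOf M B hB p = .pt a) :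
    p = point M B hB a :=
  (SumData.exists_eq_emb (D := sumData M B hB) hp).elim fun _ hx => hx

theorem exists_eq_embSeq {p : codeStr M B hB} {n : ℕ} (hp : partOf M B hB p = .seq n) :
    ∃ x, p = embSeq M B hB n x := SumData.exists_eq_emb hp

theorem code_main (p : codeStr M B hB) :
    Main (codeStr M B hB) p = if partOf M B hB p = .main then 1 else 0 :=
  (sumData M B hB).sum_relMap_of_not_mem _ (auxRel_not_mem_range _) _

theorem code_mem (A : Set M) (p : codeStr M B hB) :
    Mem (codeStr M B hB) A p = if ∃ a ∈ A, partOf M B hB p = .pt a then 1 else 0 :=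
  (sumData M B hB).sum_relMap_of_not_mem _ (auxRel_not_mem_range _) _

theorem code_slice (h : M → ℕ) (p b : codeStr M B hB) : Slice (codeStr M B hB) h p b =
    if partOf M B hB p = .seq (level h (partOf M B hB b)) then 1 else 0 :=
  (sumData M B hB).sum_relMap_of_not_mem _ (auxRel_not_mem_range _) _

theorem code_cst (a : M) : cst (codeStr M B hB) a = point M B hB a :=
  (sumData M B hB).sum_funMap_of_not_mem _ (auxFun_not_mem_range _) _

theorem code_name (p : codeStr M B hB) : name (codeStr M B hB) p =
    auxFunMap M B 1 .name fun _ => partOf M B hB p := by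
  have h : (fun k => partOf M B hB ((![p] : Fin 1 → codeStr M B hB) k)) =
      fun _ => partOf M B hB p := by
    ext k; fin_cases k; rfl
  rw [← h]
  exact (sumData M B hB).sum_funMap_of_not_mem _ (auxFun_not_mem_range _) _

theorem code_name_point (a : M) : name (codeStr M B hB) (point M B hB a) = embMain M B hB a :=
  code_name _

theorem partOf_name (p : codeStr M B hB) :
    partOf M B hB (name (codeStr M B hB) p) = .main := by
  rw [code_name]
  show (auxFunMap M B 1 .name fun _ => partOf M B hB p).1 = .main
  unfold auxFunMap
  rcases partOf M B hB p with _ | a | n <;> rfl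

theorem partOf_witness (h : M → ℕ) (p : codeStr M B hB) :
    partOf M B hB (witness (codeStr M B hB) h p) = .seq (level h (partOf M B hB p)) := by
  have : witness (codeStr M B hB) h p = auxFunMap M B 1 (.witness h)
      (fun k => partOf M B hB ((![p] : Fin 1 → codeStr M B hB) k)) :=
    (sumData M B hB).sum_funMap_of_not_mem _ (auxFun_not_mem_range _) _
  rw [this]
  rfl

theorem code_setAxioms : SetAxioms (codeStr M B hB) where
  discrete A x := by
    rw [code_mem]
    exact (ite_eq_or_eq _ _ _).symm
  mono p x := by
    rw [code_mem, code_mem, ite_eq_right_iff, ite_eq_left_iff]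
    by_cases h : ∃ a ∈ p.1.1, partOf M B hB x = .pt a
    · obtain ⟨a, ha, hx⟩ := h
      exact Or.inr fun hn => absurd ⟨a, p.2 ha, hx⟩ hn
    · exact Or.inl fun h' => absurd h' h
  inter A A' x := by
    rw [code_mem, code_mem, code_mem, ite_eq_right_iff, ite_eq_right_iff, ite_eq_left_iff]
    by_cases h : ∃ a ∈ A, partOf M B hB x = .pt a
    · by_cases h' : ∃ a ∈ A', partOf M B hB x = .pt a
      · obtain ⟨a, ha, hx⟩ := h
        obtain ⟨a', ha', hx'⟩ := h'
        obtain rfl := PartIdx.pt.inj (hx.symm.trans hx')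
        exact Or.inr (Or.inr fun hn => absurd ⟨a, ⟨ha, ha'⟩, hx⟩ hn)
      · exact Or.inr (Or.inl fun h1 => absurd h1 h')
    · exact Or.inl fun h' => absurd h' h
  compl A x := by
    rw [code_mem, code_mem, code_mem, ite_eq_right_iff, ite_eq_left_iff, ite_eq_left_iff]
    by_cases h : ∃ a ∈ Set.univ, partOf M B hB x = .pt a
    · obtain ⟨a, -, hx⟩ := h
      by_cases ha : a ∈ A
      · exact Or.inr (Or.inl fun hn => absurd ⟨a, ha, hx⟩ hn)
      · exact Or.inr (Or.inr fun hn => absurd ⟨a, ha, hx⟩ hn)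
    · exact Or.inl fun h' => absurd h' h
  empty x := by
    rw [code_mem]
    simp
  singleton a x := by
    rw [code_mem, ite_eq_right_iff, code_cst]
    by_cases h : ∃ b ∈ ({a} : Set M), partOf M B hB x = .pt b
    · obtain ⟨b, rfl, hx⟩ := h
      exact Or.inr (eq_point hx)
    · exact Or.inl fun h' => absurd h' h
  mem_cst a := by
    rw [code_mem, code_cst]
    exact if_pos ⟨a, rfl, rfl⟩

theorem code_nameAxioms : NameAxioms M (codeStr M B hB) where
  discrete x := by
    rw [code_main]
    exact (ite_eq_or_eq _ _ _).symm
  main_name x := by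
    rw [code_main]
    exact if_pos (partOf_name x)
  dense x := by
    rw [code_main, ite_eq_right_iff]
    by_cases h : partOf M B hB x = .main
    · right
      intro ε hε
      obtain ⟨a, rfl⟩ := exists_eq_embMain h
      refine ⟨point M B hB a, ?_⟩
      have h1 : Mem (codeStr M B hB) Set.univ (point M B hB a) = 1 :=
        (code_mem _ _).trans (if_pos ⟨a, trivial, rfl⟩)
      rw [h1, code_name_point, dist_self]
      simpa using hε
    · exact Or.inl fun h' => absurd h' h
  dist_name a b := by
    rw [code_cst, code_cst, code_name_point, code_name_point]
    exact SumData.dist_emb (D := sumData M B hB) .main a b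
  fun_name n f a := by
    simp only [code_cst, code_name_point]
    exact (sumData M B hB).sum_funMap_emb .main f a
  rel_name n r a := by
    simp only [code_cst, code_name_point]
    exact congrArg _ ((sumData M B hB).sum_relMap_emb .main r a)

theorem slice_ne_zero_iff {h : M → ℕ} {p b : codeStr M B hB} :
    ¬ Slice (codeStr M B hB) h p b = 0 ↔
      partOf M B hB p = .seq (level h (partOf M B hB b)) := by
  rw [code_slice, ite_eq_right_iff]
  simp

theorem slice_eq_one_iff {h : M → ℕ} {p b : codeStr M B hB} :
    Slice (codeStr M B hB) h p b = 1 ↔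
      partOf M B hB p = .seq (level h (partOf M B hB b)) := by
  rw [code_slice, ite_eq_left_iff]
  simp

theorem code_funMap_seq {n k : ℕ} (f : (unaryVocab L₀).Functions k) (x : Fin k → (B n).unarize) :
    (codeStr M B hB).funMap k ((inclPart L L₀ M).onFunction f) (fun i => embSeq M B hB n (x i)) =
      embSeq M B hB n ((B n).unarize.funMap k f x) :=
  (sumData M B hB).sum_funMap_emb (.seq n) f x

theorem code_relMap_seq {n k : ℕ} (f : (unaryVocab L₀).Relations k) (x : Fin k → (B n).unarize) :
    (codeStr M B hB).relMap k ((inclPart L L₀ M).onRelation f) (fun i => embSeq M B hB n (x i)) =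
      (B n).unarize.relMap k f x :=
  (sumData M B hB).sum_relMap_emb (.seq n) f x

theorem vec_embSeq {n : ℕ} (x : (B n).unarize) :
    (![embSeq M B hB n x] : Fin 1 → _) = fun i => embSeq M B hB n ((![x] : Fin 1 → _) i) := by
  ext k; fin_cases k; rfl

theorem code_sliceAxioms : SliceAxioms (codeStr M B hB) where
  discrete h x b := by
    rw [code_slice]
    exact (ite_eq_or_eq _ _ _).symm
  slice_witness h b := slice_eq_one_iff.2 (partOf_witness h b)
  closed h n f x b := by
    by_cases hx : ∃ k, Slice (codeStr M B hB) h (x k) b = 0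
    · exact Or.inl hx
    · right
      push Not at hx
      choose y hy using fun k => exists_eq_embSeq (slice_ne_zero_iff.1 (hx k))
      obtain rfl : x = _ := funext hy
      rw [code_funMap_seq, slice_eq_one_iff]
      rfl
  const_fun h f x y b := by
    rw [or_iff_not_imp_left, or_iff_not_imp_left, slice_ne_zero_iff, slice_ne_zero_iff]
    intro hx hy
    obtain ⟨x, rfl⟩ := exists_eq_embSeq hx
    obtain ⟨y, rfl⟩ := exists_eq_embSeq hy
    let f' : (unaryVocab L₀).Functions 1 := Sum.inr f
    exact (congrArg _ (vec_embSeq x)).trans ((code_funMap_seq f' ![x]).trans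
      ((code_funMap_seq f' ![y]).symm.trans (congrArg _ (vec_embSeq y)).symm))
  const_rel h f x y b := by
    rw [or_iff_not_imp_left, or_iff_not_imp_left, slice_ne_zero_iff, slice_ne_zero_iff]
    intro hx hy
    obtain ⟨x, rfl⟩ := exists_eq_embSeq hx
    obtain ⟨y, rfl⟩ := exists_eq_embSeq hy
    let f' : (unaryVocab L₀).Relations 1 := Sum.inr f
    exact (congrArg Subtype.val ((congrArg _ (vec_embSeq x)).trans ((code_relMap_seq f' ![x]).trans
      ((code_relMap_seq f' ![y]).symm.trans (congrArg _ (vec_embSeq y)).symm)))).le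

/-- The slice at b is exactly one summand of the sequence, so relativized sentences at b are
evaluated there. -/
theorem code_slice_iso (h : M → ℕ) (b : codeStr M B hB) (hne : _) (hcl : _) :
    (B (level h (partOf M B hB b))).unarize.Iso
      (((codeStr M B hB).reduct (inclPart L L₀ M)).restrict
        ((codeStr M B hB).slice (sliceSym h) b) hne hcl) := by
  refine (sumData M B hB).iso_restrict_sum (.seq (level h (partOf M B hB b))) ?_ hne hcl
  ext p
  refine slice_eq_one_iff.trans ⟨fun hp => ?_, ?_⟩
  · obtain ⟨x, rfl⟩ := exists_eq_embSeq hp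
    exact ⟨x, rfl⟩
  · rintro ⟨x, rfl⟩
    rfl

theorem code_main_iso (hne : _) (hcl : _) :
    M.Iso (((codeStr M B hB).reduct (inclMain L L₀ M)).restrict
      ((codeStr M B hB).truthSet mainSym) hne hcl) := by
  refine (sumData M B hB).iso_restrict_sum .main ?_ hne hcl
  ext p
  have : Main (codeStr M B hB) p = 1 ↔ partOf M B hB p = .main := by
    rw [code_main, ite_eq_left_iff]
    simp
  refine this.trans ⟨fun hp => ?_, ?_⟩
  · obtain ⟨x, rfl⟩ := exists_eq_embMain hp
    exact ⟨x, rfl⟩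
  · rintro ⟨x, rfl⟩
    rfl

theorem code_closedSet : ((codeStr M B hB).reduct (inclMain L L₀ M)).ClosedSet
    ((codeStr M B hB).truthSet mainSym) := by
  have key : ∀ p, Main (codeStr M B hB) p = 1 ↔ partOf M B hB p = .main := fun p => by
    rw [code_main, ite_eq_left_iff]
    simp
  intro n f x hx
  choose y hy using fun k => exists_eq_embMain ((key _).1 (hx k))
  obtain rfl : x = _ := funext hy
  exact (key _).2 (congrArg (partOf M B hB) ((sumData M B hB).sum_funMap_emb .main f y))

end

end Code

/-! ### From a failure of compactness to the characterization. -/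

namespace MetricLogic

open Code

variable {ℒ : MetricLogic.{u, v}} {L L₀ : Vocab.{u}}

open Classical in
theorem str_codeStr (hsum : ℒ.ClosedUnderDiscreteSums) {M : MetricStr L} {B : ℕ → MetricStr L₀}
    (hB : Equicontinuous B) (hM : ℒ.Str M) (hBs : ∀ n, ℒ.Str (B n)) :
    ℒ.Str (codeStr M B hB) := by
  refine (sumData M B hB).str_sum hsum ?_ ?_
  · rintro (_ | a | n)
    · exact Or.inl hM
    · exact Or.inr ⟨instSubsingletonPointStr, fun n => inferInstanceAs (IsEmpty PEmpty)⟩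
    · exact Or.inl (str_unarize hsum (hBs n))
  · rintro n (r | r) p
    · exact Or.inl rfl
    · show auxRelMap M n r p = 0 ∨ auxRelMap M n r p = 1
      cases r <;> exact (ite_eq_or_eq _ _ _).symm

/-- A failure of `[ω, ω]`-compactness, in the form of an increasing sequence of theories. -/
theorem exists_sequence_of_not_bracketCompact (h : ¬ ℒ.BracketCompact ℵ₀ ℵ₀) :
    ∃ (L₀ : Vocab.{u}) (T : ℕ → Set (ℒ.Sent L₀)) (B : ℕ → MetricStr L₀), Equicontinuous B ∧
      (∀ n, ℒ.Str (B n)) ∧ (∀ m n, m ≤ n → ∀ φ ∈ T m, ℒ.val (B n) φ = 1) ∧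
      ∀ K, ℒ.Str K → ¬ ∀ n, ∀ φ ∈ T n, ℒ.val K φ = 1 := by
  simp only [BracketCompact, not_forall] at h
  obtain ⟨L₀, 𝒯, ⟨Δ, E, hmod⟩, hcount, hfin, hunsat⟩ := h
  -- An empty family is finite, so its union would be satisfiable; nonemptiness allows an
  -- enumeration by ℕ.
  have hne : 𝒯.Nonempty := by
    by_contra hempty
    rw [Set.not_nonempty_iff_eq_empty] at hempty
    exact hunsat (hfin _ subset_rfl (by
      rw [hempty, Cardinal.mk_eq_zero]; exact Cardinal.aleph0_pos))
  obtain ⟨T, rfl⟩ := (Cardinal.le_aleph0_iff_set_countable.1 hcount).exists_eq_range hne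
  have hex : ∀ n, ∃ B, ℒ.Models B (⋃₀ (T '' Set.Iic n)) := fun n =>
    hfin _ (Set.image_subset_range _ _)
      (Cardinal.lt_aleph0_iff_set_finite.2 ((Set.finite_Iic n).image T))
  choose B hB using hex
  have hBT : ∀ m n, m ≤ n → ∀ φ ∈ T m, ℒ.val (B n) φ = 1 := fun m n hmn φ hφ =>
    (hB n).2 φ ⟨T m, ⟨m, hmn, rfl⟩, hφ⟩
  -- All B_n are models of T_0, so the moduli belonging to this one theory serve the whole sequence.
  have hmod' := fun n => hmod (T 0) ⟨0, rfl⟩ (B n) ⟨(hB n).1, hBT 0 n n.zero_le⟩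
  refine ⟨L₀, T, B, ⟨fun k f ε hε => ?_, fun k f ε hε => ?_⟩, fun n => (hB n).1, hBT,
    fun K hK hall => hunsat ⟨K, hK, ?_⟩⟩
  · exact ⟨Δ k f ε, ((hmod' 0).1 k f ε hε).1, fun m => ((hmod' m).1 k f ε hε).2⟩
  · exact ⟨E k f ε, ((hmod' 0).2 k f ε hε).1, fun m => ((hmod' m).2 k f ε hε).2⟩
  · rintro φ ⟨_, ⟨n, rfl⟩, hφ⟩
    exact hall n φ hφ

open Classical in
-- The coding structure shows that copies of `M` occur as main parts. Completeness and the
-- cardinality bound serve only the converse, that no other structures occur.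
theorem isRPCDelta_of_not_bracketCompact (hreg : ℒ.IsRegular) (hsum : ℒ.ClosedUnderDiscreteSums)
    (hnull : ℒ.ReplacesNullarySymbols) (h : ¬ ℒ.BracketCompact ℵ₀ ℵ₀) {M : MetricStr L}
    (hM : ℒ.Str M) (hcomplete : CompleteSpace M)
    (hcard : ∀ κ : Cardinal.{u}, IsMeasurableCardinal κ → #M < κ) : ℒ.IsRPCDelta M := by
  obtain ⟨L₀, T, B, hB, hBs, hBT, hunsat⟩ := exists_sequence_of_not_bracketCompact h
  choose nul hnul using hnull L₀
  choose rel hrel using fun (h : M → ℕ) (φ : ℒ.Sent (unaryVocab L₀)) =>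
    exists_relativization (L := L) hreg h φ
  have hax : ℒ.Axiomatizable fun N : MetricStr (codeVocab L L₀ M) =>
      (SetAxioms N ∧ NameAxioms M N ∧ SliceAxioms N) ∧
      ∀ h : M → ℕ, ∀ m, ∀ φ : T m, ∀ b : N, Mem N {a | m ≤ h a} b = 0 ∨
        ℒ.val (N.withConst fun _ : PUnit.{u + 1} => b) (rel h (nul φ)) = 1 :=
    (axiomatizable_setAxioms.and ((axiomatizable_nameAxioms M).and axiomatizable_sliceAxioms)).and
      (Axiomatizable.forall fun h => Axiomatizable.forall fun m => Axiomatizable.forall fun φ =>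
        axiomatizable_relativized h m _)
  obtain ⟨S, hS⟩ := hax
  have hK := str_codeStr hsum hB hM hBs
  refine ⟨codeVocab L L₀ M, inclMain L L₀ M, inclMain_injective, mainSym, S, ?_, ?_⟩
  · intro N hN x
    rw [MetricStr.fin_one_eq x]
    exact ((hS N hN.1).1 hN.2).1.2.1.discrete _
  intro A
  constructor
  · intro hA
    refine ⟨codeStr M B hB, ⟨hK, (hS _ hK).2 ⟨⟨code_setAxioms, code_nameAxioms, code_sliceAxioms⟩,
      ?_⟩⟩, ⟨_, code_nameAxioms.main_name (Classical.arbitrary _)⟩, code_closedSet,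
      hA.trans (code_main_iso _ _)⟩
    intro h m φ b
    rw [or_iff_not_imp_left, code_mem, ite_eq_right_iff, not_forall]
    rintro ⟨⟨a, ha, hb⟩, -⟩
    have hsl := code_sliceAxioms (M := M) (B := B) (hB := hB)
    have := hrel h (nul φ) _ hK (hsl.isDiscrete h) (hsl.slice_nonempty h) (hsl.closedSet h) b
    -- At the point of a with m ≤ h a the slice is the unarized B_{h(a)}, and B_{h(a)} satisfies
    -- T_m.
    rw [this.2, ← ℒ.val_iso _ (str_unarize hsum (hBs _)) this.1 (code_slice_iso h b _ _),
      hnul _ _ (hBs _) (str_unarize hsum (hBs _)), hb]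
    exact hBT m _ ha φ φ.2
  · rintro ⟨N, ⟨hN, hNS⟩, hne, hcl, hiso⟩
    obtain ⟨⟨hset, hname, hsl⟩, hrelN⟩ := (hS N hN).1 hNS
    refine hiso.trans (hname.iso hset ?_ hne hcl).symm
    exact exists_eq_cst_of_axioms hsum hcard hunsat hnul hrel hN hset hsl
      fun h m φ hφ => hrelN h m ⟨φ, hφ⟩

end MetricLogic

theorem theorem4p6 (ℒ : MetricLogic.{u, v}) (hreg : ℒ.IsRegular)
    (hsum : ℒ.ClosedUnderDiscreteSums) (hnull : ℒ.ReplacesNullarySymbols) :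
    (¬ ℒ.BracketCompact ℵ₀ ℵ₀ →
      ∀ (L : Vocab.{u}) (M : MetricStr L), ℒ.Str M → CompleteSpace M →
        (∀ κ : Cardinal.{u}, IsMeasurableCardinal κ → #M < κ) → ℒ.IsRPCDelta M) ∧
    ((¬ ∃ κ : Cardinal.{u}, IsMeasurableCardinal κ) → ¬ ℒ.BracketCompact ℵ₀ ℵ₀ →
      ∀ (L : Vocab.{u}) (M : MetricStr L), ℒ.Str M → CompleteSpace M →
        ℒ.IsRPCDelta M) ∧
    List.TFAE [
      ¬ ℒ.BracketCompact ℵ₀ ℵ₀,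
      ℒ.IsRPCDelta omegaLT,
      ∀ (L : Vocab.{u}) (M : MetricStr L), ℒ.Str M → CompleteSpace M →
        (∀ κ : Cardinal.{u}, IsMeasurableCardinal κ → #M < κ) → ℒ.IsRPCDelta M] := by
  have h13 : ¬ ℒ.BracketCompact ℵ₀ ℵ₀ →
      ∀ (L : Vocab.{u}) (M : MetricStr L), ℒ.Str M → CompleteSpace M →
        (∀ κ : Cardinal.{u}, IsMeasurableCardinal κ → #M < κ) → ℒ.IsRPCDelta M :=
    fun h L M hM hc hcard =>
      MetricLogic.isRPCDelta_of_not_bracketCompact hreg hsum hnull h hM hc hcard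
  refine ⟨h13, fun hno h L M hM hc => h13 h L M hM hc fun κ hκ => absurd ⟨κ, hκ⟩ hno, ?_⟩
  tfae_have 1 → 3 := h13
  tfae_have 3 → 2 := fun h => by
    refine h _ _ (MetricLogic.str_omegaLT hsum) ?_ fun κ hκ => ?_
    -- A Cauchy sequence in the discrete metric is eventually constant.
    · refine Metric.complete_of_cauchySeq_tendsto fun s hs => ?_
      obtain ⟨n, hn⟩ := Metric.cauchySeq_iff'.1 hs 1 one_pos
      refine ⟨s n, tendsto_const_nhds.congr' (Filter.eventually_atTop.2 ⟨n, fun m hm => ?_⟩)⟩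
      by_contra hne
      exact absurd (hn m hm) (not_lt.2 (if_neg (Ne.symm hne)).ge)
    · refine lt_of_eq_of_lt ?_ hκ.1
      exact (Cardinal.mk_uLift ℕ).trans (by simp)
  tfae_have 2 → 1 := MetricLogic.not_bracketCompact_of_isRPCDelta_omegaLT
  tfae_finish
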